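/- Let $n\ge 0$, $X=\{1,\dots,n\}$, $\alpha=(\alpha_1,\dots,\alpha_n)$ a sequence of nonnegative integers, and $\mathcal R(\alpha)$ the set of all words of length $\alpha_1+\cdots+\alpha_n$ that contain each letter $x\in X$ exactly $\alpha_x$ times. Let $U\subseteq X\times X$. For a word $w=x_1x_2\cdots x_m$ put $$\mathrm{inv}'_U w=\#\{(i,j): 1\le i<j\le m,\ (x_i,x_j)\in U\},\qquad \mathrm{maj}'_U w=\sum_{1\le i\le m-1,\ (x_i,x_{i+1})\in U} i .$$ The graphical sorting index $\mathrm{sor}'_U w$ is computed by straight selection sort. Start with the value $0$. For $i=m,m-1,\dots,1$ in turn: let $x_j$ be the largest letter among $x_1,\dots,x_i$ of the current word (if it occurs several times there, take the occurrence with the largest index $j$); increase the value by the number of $h\in\{j+1,\dots,i\}$ with $(x_j,x_h)\in U$; then interchange the letters in positions $j$ and $i$. An ordered bipartition of a finite set $S$ is a sequence $(B_1,\dots,B_k)$ of nonempty, pairwise disjoint sets (the blocks) with union $S$, each of which is marked as underlined or not underlined. A relation $V$ on $S$ is bipartitional with these blocks if $(x,y)\in V$ holds exactly when either $x\in B_i$,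 $y\in B_j$ with $i<j$, or $x$ and $y$ lie in the same underlined block. Let $S=\{x\in X:\alpha_x\ge 1\}$ be the set of letters that occur in the words of $\mathcal R(\alpha)$, and let $$U_\alpha=\{(x,y)\in U: x,y\in S\}\setminus\{(x,x):\alpha_x=1\}$$ be the set of those pairs of $U$ that can occur at two different positions of a word in $\mathcal R(\alpha)$. (If every $\alpha_x\ge1$ and $U$ contains no pair $(x,x)$ with $\alpha_x=1$, then $S=X$ and $U_\alpha=U$.) **Theorem.** The statistics $\mathrm{sor}'_U$, $\mathrm{inv}'_U$ and $\mathrm{maj}'_U$ are equidistributed on $\mathcal R(\alpha)$ (each value is taken equally often by all three) if and only if $U_\alpha$ has the following properties: 1. $U_\alpha$ is a bipartitional relation on $S$, with blocks $B_1,\dots,B_k$, none of which is underlined; 2. if $(x,y)\in U_\alpha$, then $x>y$; 3. $|B_i|\le 2$ for all $1\le i\le k-1$; 4. if $|B_i|=2$ for some $1\le i\le k-1$, then $\alpha_{\max B_i}=1$. -/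

import Mathlib

namespace GraphicalSorting

open Classical in
/-- The graphical inversion number of the word `w = x_1 ... x_m`: the number of pairs of
positions `i < j` with `(x_i, x_j) ∈ U`. A word of length `m` in the letters `1 < ... < n` is a
function `Fin m → Fin n`. -/
noncomputable def invU {n m : ℕ} (U : Set (Fin n × Fin n)) (w : Fin m → Fin n) : ℕ :=
  (Finset.univ.filter
    (fun p : Fin m × Fin m => p.1 < p.2 ∧ (w p.1, w p.2) ∈ U)).card

open Classical in
/-- The graphical descent set: the positions `i` (counted from `0`) that have a next position
`i + 1` and satisfy `(x_i, x_{i+1}) ∈ U`. -/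
noncomputable def desU {n m : ℕ} (U : Set (Fin n × Fin n)) (w : Fin m → Fin n) :
    Finset (Fin m) :=
  Finset.univ.filter
    (fun i : Fin m => ∃ h : i.val + 1 < m, (w i, w ⟨i.val + 1, h⟩) ∈ U)

/-- The graphical major index: the sum of the graphical descents. Positions in a word are counted
from `1` here, so the element `i` of `Fin m` contributes `i + 1`. -/
noncomputable def majU {n m : ℕ} (U : Set (Fin n × Fin n)) (w : Fin m → Fin n) : ℕ :=
  ∑ i ∈ desU U w, (i.val + 1)

theorem maxPositions_nonempty {n m : ℕ} (w : Fin (m + 1) → Fin n) :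
    (Finset.univ.filter (fun j : Fin (m + 1) => ∀ h, w h ≤ w j)).Nonempty := by
  obtain ⟨j, hj⟩ := Finite.exists_max w
  exact ⟨j, by simpa using hj⟩

/-- The position of the largest letter of a nonempty word; among several occurrences of that
letter, the last one. -/
def lastMaxPos {n m : ℕ} (w : Fin (m + 1) → Fin n) : Fin (m + 1) :=
  (Finset.univ.filter (fun j : Fin (m + 1) => ∀ h, w h ≤ w j)).max' (maxPositions_nonempty w)

/-- The word that remains to be sorted after one step of straight selection sort: the last
occurrence of the largest letter is interchanged with the letter in the last position, and this
last position, which now holds its final letter, is dropped. -/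
def sortStep {n m : ℕ} (w : Fin (m + 1) → Fin n) : Fin m → Fin n :=
  fun i => w (Equiv.swap (lastMaxPos w) (Fin.last m) i.castSucc)

open Classical in
/-- The graphical sorting index: run straight selection sort; whenever the letter `x_j` is moved
to the last unsorted position, count the positions `h > j`, up to that last unsorted position,
with `(x_j, x_h) ∈ U`. -/
noncomputable def sorU {n : ℕ} (U : Set (Fin n × Fin n)) :
    (m : ℕ) → (Fin m → Fin n) → ℕ
  | 0, _ => 0
  | m + 1, w =>
      (Finset.univ.filter
        (fun h : Fin (m + 1) => lastMaxPos w < h ∧ (w (lastMaxPos w), w h) ∈ U)).card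
      + sorU U m (sortStep w)

/-- The rearrangement class of `α`: the words that contain every letter `x` exactly `α x`
times. -/
def rearrangements {n : ℕ} (α : Fin n → ℕ) : Set (Fin (∑ x, α x) → Fin n) :=
  {w | ∀ x, (Finset.univ.filter (fun i => w i = x)).card = α x}

/-- Two statistics are equidistributed on a finite set `R` of words if each value is taken by
both equally often. -/
def Equidistributed {W : Type*} (R : Set W) (f g : W → ℕ) : Prop :=
  ∀ k : ℕ, {w ∈ R | f w = k}.ncard = {w ∈ R | g w = k}.ncard

/-- An ordered bipartition of a finite set `S`: a sequence of nonempty disjoint blocks with union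
`S`, each of which is underlined or not. -/
structure OrderedBipartition {X : Type*} [DecidableEq X] (S : Finset X) where
  k : ℕ
  block : Fin k → Finset X
  underlined : Fin k → Prop
  nonempty : ∀ i, (block i).Nonempty
  disjoint : ∀ i j, i ≠ j → Disjoint (block i) (block j)
  cover : Finset.univ.biUnion block = S

/-- The bipartitional relation that an ordered bipartition determines. -/
def OrderedBipartition.rel {X : Type*} [DecidableEq X] {S : Finset X}
    (B : OrderedBipartition S) : Set (X × X) :=
  {p | (∃ i j, i < j ∧ p.1 ∈ B.block i ∧ p.2 ∈ B.block j) ∨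
       (∃ i, B.underlined i ∧ p.1 ∈ B.block i ∧ p.2 ∈ B.block i)}

/-- The letters that occur in the words of the rearrangement class of `α`. -/
def occurring {n : ℕ} (α : Fin n → ℕ) : Finset (Fin n) :=
  Finset.univ.filter (fun x => 1 ≤ α x)

/-- The relation `U` without the pairs that never occur at two different positions of a word of
the rearrangement class of `α`: those with a letter of multiplicity `0`, and the pairs `(x, x)`
where `x` has multiplicity `1`. -/
def reduced {n : ℕ} (α : Fin n → ℕ) (U : Set (Fin n × Fin n)) : Set (Fin n × Fin n) :=
  {p ∈ U | p.1 ∈ occurring α ∧ p.2 ∈ occurring α ∧ ¬ (p.1 = p.2 ∧ α p.1 = 1)}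

end GraphicalSorting

/-! A pair of `U` matters only if it can occur at two different positions of a word, so `U` may be
replaced by its reduction `V`. Conditions 1 and 2 say that `V` is a strict weak order contained in
`>`: negative transitivity (`DescWeakOrder`) makes incomparability an equivalence relation, and its
classes are the blocks. Conditions 3 and 4 then become `SmallBlocks`.

Sufficiency. For inv and maj, Foata's transformation works for every strict weak order
(`revInv_foata`). For sor and inv, `sortToInv` takes out the last largest letter `a` as selection
sort does, transforms the remaining word recursively, and reinserts `a` at its old position `j`.
This is a bijection that keeps the positions of the largest letter. Both statistics gain the number
of letters from `j` on that are `V`-below `a`, counted for sor before and for inv after the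
transformation of the remaining word. Under `SmallBlocks`, as soon as some remaining letter is below
`a`, those that are not are copies of one letter that no remaining letter exceeds. Its positions do
not change, so the two counts agree (`sorU_eq_invU_sortToInv`).

Necessity comes from extreme values. The increasing word has sor 0, so some word has inv 0, and its
reversal has all its `V`-pairs as inversions. Hence sor also attains the number of all `V`-pairs.
Since sor sees only decreasing pairs, `V` is contained in `>` (`lt_of_mem_reduced`). Next, inv 0
implies maj 0, so the words with inv 0 and those with maj 0 coincide, and a failure of negative
transitivity would separate them (`descWeakOrder_reduced`). Finally `sortToInv` maps the words of
maximal sor injectively to those of maximal inv. Equal numbers make this map onto, so every preimage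
of a word of maximal inv has maximal sor (`MaxReflecting`). A block that is too large yields a
preimage without this property (`MaxReflecting.below_of_ne`). -/

namespace GraphicalSorting

/-! ### Pair counts and the bijection behind selection sort -/

open Classical in
/-- The indicator of a relation. -/
noncomputable def ind {A : Type*} (V : Set (A × A)) (x y : A) : ℕ := if (x, y) ∈ V then 1 else 0

/-- The number of occurrences of the letter `x` in `w`. -/
def cnt {n m : ℕ} (w : Fin m → Fin n) (x : Fin n) : ℕ :=
  (Finset.univ.filter (fun i => w i = x)).card

/-- The number of ordered pairs of different positions that carry a pair of `V`. -/
noncomputable def offPairs {n m : ℕ} (V : Set (Fin n × Fin n)) (w : Fin m → Fin n) : ℕ :=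
  ∑ i, ∑ j, if i = j then 0 else ind V (w i) (w j)

/-- The number of letters from position `j` on that are `V`-below `a`. -/
noncomputable def below {n m : ℕ} (V : Set (Fin n × Fin n)) (a : Fin n) (j : Fin (m + 1))
    (v : Fin m → Fin n) : ℕ :=
  ∑ h : Fin m, if j ≤ h.castSucc then ind V a (v h) else 0

/-- The bijection that carries the sorting index to the inversion number. -/
def sortToInv {n : ℕ} : (m : ℕ) → (Fin m → Fin n) → (Fin m → Fin n)
  | 0, w => w
  | m + 1, w =>
      Fin.insertNth (α := fun _ => Fin n) (lastMaxPos w) (w (lastMaxPos w))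
        (sortToInv m (sortStep w))

/-- The word whose sorting step moves the letter `a` from position `j` and leaves `v`. -/
def unsort {n m : ℕ} (j : Fin (m + 1)) (a : Fin n) (v : Fin m → Fin n) : Fin (m + 1) → Fin n :=
  fun i => Fin.snoc (α := fun _ => Fin n) v a (Equiv.swap j (Fin.last m) i)

variable {n m : ℕ}

theorem ind_eq_one {A : Type*} {V : Set (A × A)} {x y : A} (h : (x, y) ∈ V) : ind V x y = 1 := by
  simp [ind, h]

theorem ind_eq_zero {A : Type*} {V : Set (A × A)} {x y : A} (h : (x, y) ∉ V) : ind V x y = 0 := by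
  simp [ind, h]

theorem ind_congr {A B : Type*} {V : Set (A × A)} {V' : Set (B × B)} {x y : A} {x' y' : B}
    (h : (x, y) ∈ V ↔ (x', y') ∈ V') : ind V x y = ind V' x' y' := by
  by_cases h' : (x', y') ∈ V'
  · rw [ind_eq_one h', ind_eq_one (h.2 h')]
  · rw [ind_eq_zero h', ind_eq_zero (mt h.1 h')]

/-! ### One step of selection sort and its inverse -/

theorem le_lastMaxPos (w : Fin (m + 1) → Fin n) (h : Fin (m + 1)) : w h ≤ w (lastMaxPos w) := by
  have := Finset.max'_mem _ (maxPositions_nonempty w)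
  rw [Finset.mem_filter] at this
  exact this.2 h

theorem lt_of_lastMaxPos_lt (w : Fin (m + 1) → Fin n) {h : Fin (m + 1)} (hh : lastMaxPos w < h) :
    w h < w (lastMaxPos w) := by
  refine lt_of_le_of_ne (le_lastMaxPos w h) fun he => ?_
  refine absurd (Finset.le_max' (Finset.univ.filter (fun j : Fin (m + 1) => ∀ h, w h ≤ w j)) h ?_)
    (not_le.2 hh)
  simp only [Finset.mem_filter, Finset.mem_univ, true_and]
  intro i
  rw [he]
  exact le_lastMaxPos w i

theorem lastMaxPos_eq {w : Fin (m + 1) → Fin n} {j : Fin (m + 1)} (h1 : ∀ h, w h ≤ w j)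
    (h2 : ∀ h, j < h → w h < w j) : lastMaxPos w = j := by
  rcases lt_trichotomy (lastMaxPos w) j with h | h | h
  · exact absurd (lt_of_lastMaxPos_lt w h) (not_lt.2 (h1 _))
  · exact h
  · exact absurd (le_lastMaxPos w j) (not_le.2 (h2 _ h))

theorem snoc_sortStep (w : Fin (m + 1) → Fin n) :
    Fin.snoc (α := fun _ => Fin n) (sortStep w) (w (lastMaxPos w))
      = w ∘ Equiv.swap (lastMaxPos w) (Fin.last m) := by
  funext i
  refine Fin.lastCases ?_ (fun i => ?_) i
  · simp
  · simp [sortStep]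

theorem unsort_lastMaxPos (w : Fin (m + 1) → Fin n) :
    unsort (lastMaxPos w) (w (lastMaxPos w)) (sortStep w) = w := by
  funext i
  simp only [unsort, snoc_sortStep, Function.comp_apply, Equiv.swap_apply_self]

theorem unsort_apply_self (j : Fin (m + 1)) (a : Fin n) (v : Fin m → Fin n) :
    unsort j a v j = a := by
  simp [unsort]

theorem swap_castSucc_of_lt {j : Fin (m + 1)} {h : Fin m} (hj : h.castSucc < j) :
    Equiv.swap j (Fin.last m) h.castSucc = h.castSucc :=
  Equiv.swap_apply_of_ne_of_ne hj.ne (Fin.castSucc_lt_last h).ne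

/-- The interchange puts the former last letter at `j`, so the letters strictly after `j` in the
word are those from `j` on in the remaining word. This is why `below` uses `≤` where the sorting
index uses `<`. -/
theorem lt_swap_castSucc_iff (j : Fin (m + 1)) (h : Fin m) :
    j < Equiv.swap j (Fin.last m) h.castSucc ↔ j ≤ h.castSucc := by
  by_cases he : h.castSucc = j
  · subst he
    simp [Fin.castSucc_lt_last]
  · rw [Equiv.swap_apply_of_ne_of_ne he (Fin.castSucc_lt_last h).ne]
    exact ⟨le_of_lt, fun hl => lt_of_le_of_ne hl (Ne.symm he)⟩

theorem sortStep_castSucc_lt {w : Fin (m + 1) → Fin n} {h : Fin m}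
    (hh : h.castSucc < lastMaxPos w) : sortStep w h = w h.castSucc := by
  rw [sortStep, swap_castSucc_of_lt hh]

theorem sortStep_lt {w : Fin (m + 1) → Fin n} {h : Fin m}
    (hh : lastMaxPos w ≤ h.castSucc) : sortStep w h < w (lastMaxPos w) :=
  lt_of_lastMaxPos_lt w ((lt_swap_castSucc_iff _ _).2 hh)

theorem sortStep_le (w : Fin (m + 1) → Fin n) (h : Fin m) : sortStep w h ≤ w (lastMaxPos w) :=
  le_lastMaxPos w _

/-- All copies of `a` in `v` must lie before `j`: otherwise a sorting step would choose a later
copy. -/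
theorem lastMaxPos_unsort {j : Fin (m + 1)} {a : Fin n} {v : Fin m → Fin n} (h1 : ∀ h, v h ≤ a)
    (h2 : ∀ h, v h = a → h.castSucc < j) : lastMaxPos (unsort j a v) = j := by
  have key : ∀ i : Fin (m + 1), unsort j a v (Equiv.swap j (Fin.last m) i)
      = Fin.snoc (α := fun _ => Fin n) v a i := by
    intro i; simp [unsort]
  apply lastMaxPos_eq
  · intro h
    rw [unsort_apply_self, unsort]
    refine Fin.lastCases (by simp) (fun i => ?_) (Equiv.swap j (Fin.last m) h)
    simpa using h1 i
  · intro h hj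
    rw [unsort_apply_self]
    obtain ⟨i, rfl⟩ := (Equiv.swap j (Fin.last m)).surjective h
    rw [key]
    revert hj
    refine Fin.lastCases (by simp) (fun i => ?_) i
    intro hj
    rw [lt_swap_castSucc_iff] at hj
    simp only [Fin.snoc_castSucc]
    exact lt_of_le_of_ne (h1 i) fun he => absurd (h2 i he) (not_lt.2 hj)

theorem sortStep_unsort {j : Fin (m + 1)} {a : Fin n} {v : Fin m → Fin n} (h1 : ∀ h, v h ≤ a)
    (h2 : ∀ h, v h = a → h.castSucc < j) : sortStep (unsort j a v) = v := by
  funext i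
  simp [sortStep, lastMaxPos_unsort h1 h2, unsort]

/-! ### Letter counts and pair counts under a sorting step -/

theorem cnt_eq_sum (w : Fin m → Fin n) (x : Fin n) : cnt w x = ∑ i, if w i = x then 1 else 0 := by
  simp [cnt]

theorem cnt_comp_perm (w : Fin m → Fin n) (σ : Equiv.Perm (Fin m)) (x : Fin n) :
    cnt (w ∘ σ) x = cnt w x := by
  rw [cnt_eq_sum, cnt_eq_sum]
  exact Equiv.sum_comp σ (fun i => if w i = x then 1 else 0)

theorem cnt_snoc (w : Fin m → Fin n) (a x : Fin n) :
    cnt (Fin.snoc (α := fun _ => Fin n) w a) x = cnt w x + if a = x then 1 else 0 := by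
  rw [cnt_eq_sum, cnt_eq_sum, Fin.sum_univ_castSucc]
  simp

theorem cnt_unsort (j : Fin (m + 1)) (a : Fin n) (v : Fin m → Fin n) (x : Fin n) :
    cnt (unsort j a v) x = cnt v x + if a = x then 1 else 0 := by
  rw [← cnt_snoc]
  exact cnt_comp_perm (Fin.snoc (α := fun _ => Fin n) v a) (Equiv.swap j (Fin.last m)) x

theorem cnt_sortStep (w : Fin (m + 1) → Fin n) (x : Fin n) :
    cnt w x = cnt (sortStep w) x + if w (lastMaxPos w) = x then 1 else 0 := by
  conv_lhs => rw [← unsort_lastMaxPos w]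
  rw [cnt_unsort]

theorem cnt_insertNth (j : Fin (m + 1)) (a : Fin n) (v : Fin m → Fin n) (x : Fin n) :
    cnt (Fin.insertNth (α := fun _ => Fin n) j a v) x = cnt v x + if a = x then 1 else 0 := by
  rw [cnt_eq_sum, cnt_eq_sum, Fin.sum_univ_succAbove _ j]
  simp [add_comm]

theorem cnt_sortToInv : ∀ (m : ℕ) (w : Fin m → Fin n) (x : Fin n),
    cnt (sortToInv m w) x = cnt w x
  | 0, _, _ => rfl
  | m + 1, w, x => by
      rw [sortToInv, cnt_insertNth, cnt_sortToInv m, ← cnt_sortStep]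

theorem cnt_pos_iff {w : Fin m → Fin n} {x : Fin n} : 0 < cnt w x ↔ ∃ i, w i = x := by
  simp [cnt, Finset.card_pos, Finset.Nonempty]

theorem exists_perm_of_cnt_eq {v w : Fin m → Fin n} (h : ∀ x, cnt v x = cnt w x) :
    ∃ σ : Equiv.Perm (Fin m), v = w ∘ σ := by
  have e : ∀ x, Nonempty ({i // v i = x} ≃ {i // w i = x}) := by
    intro x
    refine Fintype.card_eq.1 ?_
    rw [Fintype.card_subtype, Fintype.card_subtype]
    exact h x
  refine ⟨Equiv.ofFiberEquiv fun x => (e x).some, ?_⟩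
  funext i
  exact (Equiv.ofFiberEquiv_map _ i).symm

theorem offPairs_comp_perm (V : Set (Fin n × Fin n)) (w : Fin m → Fin n)
    (σ : Equiv.Perm (Fin m)) : offPairs V (w ∘ σ) = offPairs V w := by
  unfold offPairs
  rw [← Equiv.sum_comp σ (fun i => ∑ j, if i = j then 0 else ind V (w i) (w j))]
  refine Finset.sum_congr rfl fun i _ => ?_
  rw [← Equiv.sum_comp σ (fun j => if σ i = j then 0 else ind V (w (σ i)) (w j))]
  simp

theorem offPairs_congr {V : Set (Fin n × Fin n)} {v w : Fin m → Fin n}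
    (h : ∀ x, cnt v x = cnt w x) : offPairs V v = offPairs V w := by
  obtain ⟨σ, rfl⟩ := exists_perm_of_cnt_eq h
  exact offPairs_comp_perm V w σ

theorem offPairs_snoc (V : Set (Fin n × Fin n)) (w : Fin m → Fin n) (a : Fin n) :
    offPairs V (Fin.snoc (α := fun _ => Fin n) w a)
      = offPairs V w + (∑ h, ind V (w h) a) + ∑ h, ind V a (w h) := by
  unfold offPairs
  rw [Fin.sum_univ_castSucc]
  simp only [Fin.sum_univ_castSucc, Fin.snoc_castSucc, Fin.snoc_last, Fin.castSucc_inj,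
    if_true, add_zero, Finset.sum_add_distrib]
  congr 1
  · congr 1
    exact Finset.sum_congr rfl fun i _ => if_neg (Fin.castSucc_lt_last i).ne
  · exact Finset.sum_congr rfl fun i _ => if_neg (Fin.castSucc_lt_last i).ne'

theorem offPairs_sortStep (V : Set (Fin n × Fin n)) (w : Fin (m + 1) → Fin n) :
    offPairs V w = offPairs V (sortStep w) + (∑ h, ind V (sortStep w h) (w (lastMaxPos w)))
      + ∑ h, ind V (w (lastMaxPos w)) (sortStep w h) := by
  rw [← offPairs_snoc, snoc_sortStep, offPairs_comp_perm]

/-! ### Recursions for the inversion number and the sorting index -/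

theorem invU_eq_sum (V : Set (Fin n × Fin n)) (w : Fin m → Fin n) :
    invU V w = ∑ i, ∑ j, if i < j then ind V (w i) (w j) else 0 := by
  classical
  rw [invU, Finset.card_filter, ← Finset.univ_product_univ, Finset.sum_product]
  refine Finset.sum_congr rfl fun i _ => Finset.sum_congr rfl fun j _ => ?_
  by_cases h1 : i < j <;> by_cases h2 : (w i, w j) ∈ V <;> simp [ind, h1, h2]

theorem invU_insertNth (V : Set (Fin n × Fin n)) (j : Fin (m + 1)) (a : Fin n)
    (v : Fin m → Fin n) : invU V (Fin.insertNth (α := fun _ => Fin n) j a v)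
      = invU V v + below V a j v + ∑ h : Fin m, if h.castSucc < j then ind V (v h) a else 0 := by
  rw [invU_eq_sum, invU_eq_sum, Fin.sum_univ_succAbove _ j]
  simp only [Fin.sum_univ_succAbove _ j, Fin.insertNth_apply_same, Fin.insertNth_apply_succAbove,
    lt_irrefl, if_false, zero_add, Finset.sum_add_distrib, Fin.succAbove_lt_succAbove_iff,
    Fin.lt_succAbove_iff_le_castSucc, Fin.succAbove_lt_iff_castSucc_lt, below]
  ring

theorem sorU_succ (V : Set (Fin n × Fin n)) (w : Fin (m + 1) → Fin n) :
    sorU V (m + 1) w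
      = below V (w (lastMaxPos w)) (lastMaxPos w) (sortStep w) + sorU V m (sortStep w) := by
  classical
  rw [sorU]
  congr 1
  -- Reindexing by the interchange turns positions of the word into positions of the remaining word.
  rw [Finset.card_filter, ← Equiv.sum_comp (Equiv.swap (lastMaxPos w) (Fin.last m)),
    Fin.sum_univ_castSucc]
  simp only [Equiv.swap_apply_right, lt_irrefl, false_and, if_false, add_zero, below,
    lt_swap_castSucc_iff]
  refine Finset.sum_congr rfl fun h _ => ?_
  by_cases h1 : lastMaxPos w ≤ h.castSucc
  · simp only [h1, true_and, if_true, ind, sortStep]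
    congr
  · simp [h1]

theorem below_congr {V V' : Set (Fin n × Fin n)} {a : Fin n} {j : Fin (m + 1)}
    {v v' : Fin m → Fin n} (h : ∀ i, j ≤ i.castSucc → ((a, v i) ∈ V ↔ (a, v' i) ∈ V')) :
    below V a j v = below V' a j v' := by
  refine Finset.sum_congr rfl fun i _ => ?_
  split_ifs with hi
  · exact ind_congr (h i hi)
  · rfl

theorem below_le_sum (V : Set (Fin n × Fin n)) (a : Fin n) (j : Fin (m + 1))
    (v : Fin m → Fin n) : below V a j v ≤ ∑ h, ind V a (v h) := by
  refine Finset.sum_le_sum fun i _ => ?_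
  split_ifs <;> simp

theorem below_eq_sum {V : Set (Fin n × Fin n)} {a : Fin n} {j : Fin (m + 1)}
    {v : Fin m → Fin n} (h : ∑ h, ind V a (v h) ≤ below V a j v) :
    ∀ i : Fin m, i.castSucc < j → (a, v i) ∉ V := by
  intro i hi hV
  refine absurd h (not_le.2 (Finset.sum_lt_sum (fun i _ => ?_) ⟨i, Finset.mem_univ _, ?_⟩))
  · split_ifs <;> simp
  · rw [if_neg (not_le.2 hi), ind_eq_one hV]
    exact one_pos

/-- The sorting index depends only on the pairs `(x, y)` with `x > y`. -/
theorem sorU_congr {V V' : Set (Fin n × Fin n)} : ∀ (m : ℕ) (w : Fin m → Fin n),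
    (∀ i j, w j < w i → ((w i, w j) ∈ V ↔ (w i, w j) ∈ V')) → sorU V m w = sorU V' m w
  | 0, _, _ => rfl
  | m + 1, w, h => by
      rw [sorU_succ, sorU_succ, sorU_congr m (sortStep w) fun i j => h _ _]
      congr 1
      exact below_congr fun i hi => h _ _ (sortStep_lt hi)

theorem sorU_le_offPairs (V : Set (Fin n × Fin n)) : ∀ (m : ℕ) (w : Fin m → Fin n),
    sorU V m w ≤ offPairs V w
  | 0, _ => by simp [sorU]
  | m + 1, w => by
      rw [sorU_succ, offPairs_sortStep]
      have := sorU_le_offPairs V m (sortStep w)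
      have := below_le_sum V (w (lastMaxPos w)) (lastMaxPos w) (sortStep w)
      omega

/-! ### The bijection fixes the positions of the largest letter -/

/-- The last copy of the maximum is reinserted where it was, and the other copies lie to its left,
where neither the interchange nor the insertion moves anything. If the bound `a` does not occur,
both sides are false. -/
theorem sortToInv_eq_iff : ∀ (m : ℕ) (w : Fin m → Fin n) (a : Fin n), (∀ i, w i ≤ a) →
    ∀ i, sortToInv m w i = a ↔ w i = a
  | 0, _, _, _, _ => Iff.rfl
  | m + 1, w, a, ha, i => by
      by_cases hj : w (lastMaxPos w) = a
      · rw [sortToInv]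
        rcases Fin.eq_self_or_eq_succAbove (lastMaxPos w) i with rfl | ⟨h, rfl⟩
        · simp
        · rw [Fin.insertNth_apply_succAbove, sortToInv_eq_iff m (sortStep w) a fun i => ha _]
          rcases lt_or_ge h.castSucc (lastMaxPos w) with hl | hl
          · rw [Fin.succAbove_of_castSucc_lt _ _ hl, sortStep_castSucc_lt hl]
          · refine iff_of_false ?_ ?_
            · rw [← hj]; exact (sortStep_lt hl).ne
            · rw [← hj]
              exact (lt_of_lastMaxPos_lt w ((Fin.lt_succAbove_iff_le_castSucc _ _).2 hl)).ne
      · have hz : cnt w a = 0 := by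
          by_contra hne
          obtain ⟨i, hi⟩ := cnt_pos_iff.1 (Nat.pos_of_ne_zero hne)
          exact hj (le_antisymm (ha _) (hi ▸ le_lastMaxPos w i))
        refine iff_of_false (fun h => ?_) (fun h => ?_)
        · have := cnt_pos_iff.2 ⟨i, h⟩
          rw [cnt_sortToInv] at this
          omega
        · have := cnt_pos_iff.2 ⟨i, h⟩
          omega

theorem sortToInv_le {w : Fin m → Fin n} {a : Fin n} (h : ∀ i, w i ≤ a) (i : Fin m) :
    sortToInv m w i ≤ a := by
  have hc : 0 < cnt w (sortToInv m w i) := by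
    rw [← cnt_sortToInv]
    exact cnt_pos_iff.2 ⟨i, rfl⟩
  obtain ⟨k, hk⟩ := cnt_pos_iff.1 hc
  rw [← hk]
  exact h k

theorem lastMaxPos_sortToInv (w : Fin (m + 1) → Fin n) :
    lastMaxPos (sortToInv (m + 1) w) = lastMaxPos w ∧
      sortToInv (m + 1) w (lastMaxPos w) = w (lastMaxPos w) := by
  have he := sortToInv_eq_iff (m + 1) w _ (le_lastMaxPos w)
  have hj := (he (lastMaxPos w)).2 rfl
  refine ⟨lastMaxPos_eq ?_ ?_, hj⟩
  · intro h
    rw [hj]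
    exact sortToInv_le (le_lastMaxPos w) h
  · intro h hh
    rw [hj]
    refine lt_of_le_of_ne (sortToInv_le (le_lastMaxPos w) h) fun hne => ?_
    exact (lt_of_lastMaxPos_lt w hh).ne ((he h).1 hne)

/-- The inserted letter and its position can be read off the image as its last maximum, so each
insertion can be undone. -/
theorem sortToInv_injective : ∀ m : ℕ, Function.Injective (sortToInv (n := n) m)
  | 0 => fun _ _ h => h
  | m + 1 => fun w w' h => by
      obtain ⟨h1, h2⟩ := lastMaxPos_sortToInv w
      obtain ⟨h3, h4⟩ := lastMaxPos_sortToInv w'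
      have hj : lastMaxPos w = lastMaxPos w' := by rw [← h1, h, h3]
      have ha : w (lastMaxPos w) = w' (lastMaxPos w') := by rw [← h2, ← h4, h, hj]
      have hs : sortStep w = sortStep w' := by
        apply sortToInv_injective m
        funext i
        have hi := congrFun h ((lastMaxPos w).succAbove i)
        rw [sortToInv, sortToInv, ← hj] at hi
        simpa using hi
      rw [← unsort_lastMaxPos w, ← unsort_lastMaxPos w', ha, hs, hj]

theorem sortToInv_surjective (m : ℕ) : Function.Surjective (sortToInv (n := n) m) :=
  Finite.surjective_of_injective (sortToInv_injective m)

end GraphicalSorting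

/-! ### Foata's transformation for strict weak orders -/

namespace GraphicalSorting

/-- Moves the letters with property `P`, the first of which is `c`, to the ends of their
factors. -/
noncomputable def rotate {A : Type*} (P : A → Prop) : A → List A → List A
  | c, [] => [c]
  | c, u :: l => open Classical in if P u then c :: rotate P u l else u :: rotate P c l

open Classical in
/-- The rearrangement of a reversed word that precedes the adjunction of the letter `x` in Foata's
transformation. -/
noncomputable def rotateFor {A : Type*} (V : Set (A × A)) (x : A) : List A → List A
  | [] => []
  | v :: l => if (v, x) ∈ V then rotate (fun u => (u, x) ∈ V) v l
      else rotate (fun u => (u, x) ∉ V) v l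

/-- Foata's transformation of reversed words. -/
noncomputable def foata {A : Type*} (V : Set (A × A)) : List A → List A
  | [] => []
  | x :: l => x :: rotateFor V x (foata V l)

open Classical in
/-- The graphical inversion number of a reversed word. -/
noncomputable def revInv {A : Type*} (V : Set (A × A)) : List A → ℕ
  | [] => 0
  | x :: l => revInv V l + l.countP (fun u => (u, x) ∈ V)

open Classical in
/-- The graphical major index of a reversed word. -/
noncomputable def revMaj {A : Type*} (V : Set (A × A)) : List A → ℕ
  | [] => 0
  | [_] => 0
  | x :: v :: l => revMaj V (v :: l) + if (v, x) ∈ V then l.length + 1 else 0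

section
variable {A : Type*} {P : A → Prop} {V : Set (A × A)}

theorem rotate_perm (c : A) (l : List A) : (rotate P c l).Perm (c :: l) := by
  induction l generalizing c with
  | nil => exact List.Perm.refl _
  | cons u l ih =>
    rw [rotate]
    split_ifs
    · exact (ih u).cons c
    · exact ((ih c).cons u).trans (List.Perm.swap _ _ _)

/-- The carried letter always satisfies `P`, so an output letter before the end satisfies `P`
exactly when the input letter read at that moment does. The output thus determines every step. -/
theorem rotate_injective {c c' : A} {l l' : List A} (hc : P c) (hc' : P c')
    (h : rotate P c l = rotate P c' l') : c = c' ∧ l = l' := by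
  induction l generalizing c c' l' with
  | nil =>
    have hl := congrArg List.length h
    rw [(rotate_perm c _).length_eq, (rotate_perm c' _).length_eq] at hl
    have : l' = [] := List.length_eq_zero_iff.1 (by simpa using hl.symm)
    subst this
    simpa [rotate] using h
  | cons u l ih =>
    cases l' with
    | nil =>
      have hl := congrArg List.length h
      rw [(rotate_perm c _).length_eq, (rotate_perm c' _).length_eq] at hl
      simp at hl
    | cons u' l' =>
      rw [rotate, rotate] at h
      split_ifs at h with h1 h2 h2
      · obtain ⟨h3, h4⟩ := List.cons.inj h
        obtain ⟨h5, h6⟩ := ih h1 h2 h4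
        exact ⟨h3, by rw [h5, h6]⟩
      · exact absurd ((List.cons.inj h).1 ▸ hc) h2
      · exact absurd ((List.cons.inj h).1 ▸ hc') h1
      · obtain ⟨h3, h4⟩ := List.cons.inj h
        obtain ⟨h5, h6⟩ := ih hc hc' h4
        exact ⟨h5, by rw [h3, h6]⟩

/-- The letter still carried at the end is put last. `rotateFor_injective` uses it to tell the two
cases of `rotateFor` apart. -/
theorem rotate_getLast {c : A} {l : List A} (hc : P c) : ∀ a ∈ (rotate P c l).getLast?, P a := by
  induction l generalizing c with
  | nil => simpa [rotate] using hc
  | cons u l ih =>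
    have hne : ∀ d, rotate P d l ≠ [] := fun d h => by
      simpa [h] using (rotate_perm (P := P) d l).length_eq
    rw [rotate]
    split_ifs with h
    · rw [List.getLast?_cons_of_ne_nil (hne u)]
      exact ih h
    · rw [List.getLast?_cons_of_ne_nil (hne c)]
      exact ih hc

theorem rotateFor_perm (x : A) (l : List A) : (rotateFor V x l).Perm l := by
  cases l with
  | nil => exact List.Perm.refl _
  | cons v l =>
    rw [rotateFor]
    split_ifs <;> exact rotate_perm _ _

theorem rotate_ne_nil (c : A) (l : List A) : rotate P c l ≠ [] := fun h => by
  simpa [h] using (rotate_perm (P := P) c l).length_eq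

theorem rotateFor_injective (x : A) : Function.Injective (rotateFor V x) := by
  have key : ∀ (v v' : A) (l l' : List A), (v, x) ∈ V → (v', x) ∉ V →
      rotate (fun u => (u, x) ∈ V) v l ≠ rotate (fun u => (u, x) ∉ V) v' l' := by
    intro v v' l l' hv hv' h
    have h1 := rotate_getLast (P := fun u => (u, x) ∈ V) (l := l) hv
    have h2 := rotate_getLast (P := fun u => (u, x) ∉ V) (l := l') hv'
    rw [h] at h1
    have hs := List.getLast?_eq_some_getLast (rotate_ne_nil (P := fun u => (u, x) ∉ V) v' l')
    exact h2 _ hs (h1 _ hs)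
  intro l l' h
  have hl := (rotateFor_perm (V := V) x l).length_eq
  have hl' := (rotateFor_perm (V := V) x l').length_eq
  rw [h, hl'] at hl
  cases l with
  | nil => exact (List.length_eq_zero_iff.1 hl).symm
  | cons v l =>
    cases l' with
    | nil => simp at hl
    | cons v' l' =>
      rw [rotateFor, rotateFor] at h
      split_ifs at h with h1 h2 h2
      · obtain ⟨rfl, rfl⟩ := rotate_injective (P := fun u => (u, x) ∈ V) h1 h2 h
        rfl
      · exact absurd h (key _ _ _ _ h1 h2)
      · exact absurd h.symm (key _ _ _ _ h2 h1)
      · obtain ⟨rfl, rfl⟩ := rotate_injective (P := fun u => (u, x) ∉ V) h1 h2 h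
        rfl

theorem foata_perm (l : List A) : (foata V l).Perm l := by
  induction l with
  | nil => exact List.Perm.refl _
  | cons x l ih => exact ((rotateFor_perm x _).trans ih).cons x

theorem foata_injective : Function.Injective (foata V) := by
  intro l
  induction l with
  | nil =>
    intro l' h
    have := (foata_perm (V := V) l').length_eq
    rw [← h] at this
    exact (List.length_eq_zero_iff.1 this.symm).symm
  | cons x l ih =>
    intro l' h
    cases l' with
    | nil => simp [foata] at h
    | cons x' l' =>
      rw [foata, foata] at h
      obtain ⟨rfl, h⟩ := List.cons.inj h
      rw [ih (rotateFor_injective x h)]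

-- Each letter `u` outside the class of `c` is passed once by a carried letter, and every such
-- passage creates one inversion. Together with the pairs that `x` forms with the letters of the
-- class, the gain is the full length of the word, as a descent at its end requires.
open Classical in
theorem revInv_rotate_of_mem {x : A} {T : Set A}
    (h1 : ∀ c ∈ T, ∀ u ∈ T, (c, x) ∈ V → (u, x) ∉ V → (c, u) ∈ V ∧ (u, c) ∉ V) {c : A} {l : List A}
    (hT : ∀ u ∈ c :: l, u ∈ T) (hc : (c, x) ∈ V) :
    revInv V (rotate (fun u => (u, x) ∈ V) c l)
      = revInv V (c :: l) + l.countP (fun u => (u, x) ∉ V) := by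
  induction l generalizing c with
  | nil => simp [rotate]
  | cons u l ih =>
    have hcT : c ∈ T := hT c (by simp)
    have huT : u ∈ T := hT u (by simp)
    rw [rotate]
    split_ifs with hu
    · rw [revInv, ih (fun v hv => hT v (List.mem_cons_of_mem _ hv)) hu,
        (rotate_perm u l).countP_eq]
      simp [revInv, List.countP_cons, hu]
      ring
    · rw [revInv, ih (fun v hv => hT v (by simp at hv ⊢; tauto)) hc, (rotate_perm c l).countP_eq]
      simp [revInv, hu, h1 c hcT u huT hc hu]
      ring

-- Here every passage destroys one inversion, and the loss cancels exactly the pairs that `x` adds: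
-- no descent, no gain.
open Classical in
theorem revInv_rotate_of_notMem {x : A} {T : Set A}
    (h1 : ∀ c ∈ T, ∀ u ∈ T, (c, x) ∈ V → (u, x) ∉ V → (c, u) ∈ V ∧ (u, c) ∉ V) {c : A} {l : List A}
    (hT : ∀ u ∈ c :: l, u ∈ T) (hc : (c, x) ∉ V) :
    revInv V (rotate (fun u => (u, x) ∉ V) c l) + l.countP (fun u => (u, x) ∈ V)
      = revInv V (c :: l) := by
  induction l generalizing c with
  | nil => simp [rotate]
  | cons u l ih =>
    have hcT : c ∈ T := hT c (by simp)
    have huT : u ∈ T := hT u (by simp)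
    rw [rotate]
    split_ifs with hu
    · have := ih (c := c) (fun v hv => hT v (by simp at hv ⊢; tauto)) hc
      rw [revInv] at this
      rw [revInv, (rotate_perm c l).countP_eq]
      simp [revInv, hu, h1 u huT c hcT hu hc]
      omega
    · rw [revInv, revInv, ← ih (fun v hv => hT v (List.mem_cons_of_mem _ hv)) hu,
        (rotate_perm u l).countP_eq]
      simp [List.countP_cons, hu]
      ring

/-- Foata's theorem for strict weak orders. -/
theorem revInv_foata {T : Set A}
    (h1 : ∀ c ∈ T, ∀ u ∈ T, ∀ x ∈ T, (c, x) ∈ V → (u, x) ∉ V → (c, u) ∈ V ∧ (u, c) ∉ V)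
    (l : List A) (hl : ∀ u ∈ l, u ∈ T) : revInv V (foata V l) = revMaj V l := by
  classical
  induction l with
  | nil => simp [foata, revInv, revMaj]
  | cons x l ih =>
    have ih := ih fun u hu => hl u (List.mem_cons_of_mem _ hu)
    have hx : x ∈ T := hl x (by simp)
    have h2 := fun c hc u hu => h1 c hc u hu x hx
    cases l with
    | nil => simp [foata, rotateFor, revInv, revMaj]
    | cons v l =>
      rw [foata, revInv, (rotateFor_perm x _).countP_eq]
      have hp := foata_perm (V := V) (v :: l)
      -- The transformed word still begins with `v`, so the case distinction of `rotateFor` is the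
      -- descent condition of the original word.
      rw [foata] at ih hp ⊢
      have hT : ∀ u ∈ v :: rotateFor V v (foata V l), u ∈ T := fun u hu =>
        hl u (List.mem_cons_of_mem _ (hp.mem_iff.1 hu))
      have hlen : (rotateFor V v (foata V l)).length = l.length := by
        simpa using hp.length_eq
      rw [rotateFor, revMaj, ← ih]
      split_ifs with hv
      · rw [revInv_rotate_of_mem h2 hT hv, List.countP_cons, ← hlen,
          List.length_eq_countP_add_countP (fun u => decide ((u, x) ∈ V))]
        simp [hv]
        omega
      · rw [← revInv_rotate_of_notMem h2 hT hv, List.countP_cons]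
        simp [hv]

end

/-! ### Words as reversed lists -/

/-- A word as a list, read from right to left. -/
def revWord {n m : ℕ} (w : Fin m → Fin n) : List (Fin n) := (List.ofFn w).reverse

variable {n m : ℕ}

theorem revWord_succ (w : Fin (m + 1) → Fin n) :
    revWord w = w (Fin.last m) :: revWord (fun i => w i.castSucc) := by
  rw [revWord, List.ofFn_succ_last, List.reverse_append]
  rfl

theorem revWord_injective : Function.Injective (revWord (n := n) (m := m)) := fun _ _ h =>
  List.ofFn_injective (List.reverse_injective h)

theorem exists_ofFn_eq {l : List (Fin n)} (h : l.length = m) :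
    ∃ w : Fin m → Fin n, List.ofFn w = l := by
  subst h
  exact ⟨l.get, List.ofFn_get l⟩

theorem length_revWord (w : Fin m → Fin n) : (revWord w).length = m := by simp [revWord]

theorem card_eq_count_ofFn (w : Fin m → Fin n) (x : Fin n) :
    (Finset.univ.filter (fun i => w i = x)).card = (List.ofFn w).count x := by
  rw [← Multiset.coe_count, ← Fin.univ_val_map, Multiset.count_map, Finset.card_def,
    Finset.filter_val]
  simp only [eq_comm]

theorem countP_revWord (w : Fin m → Fin n) (p : Fin n → Prop) [DecidablePred p] :
    (revWord w).countP (fun u => p u) = ∑ i, if p (w i) then 1 else 0 := by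
  induction m with
  | zero => simp [revWord]
  | succ m ih =>
    rw [revWord_succ, List.countP_cons, ih, Fin.sum_univ_castSucc]
    simp

theorem invU_eq_revInv (V : Set (Fin n × Fin n)) (w : Fin m → Fin n) :
    invU V w = revInv V (revWord w) := by
  classical
  induction m with
  | zero => simp [revWord, revInv, invU]
  | succ m ih =>
    rw [revWord_succ, revInv, ← ih, countP_revWord, invU, invU]
    simp only [Finset.card_filter, ← Finset.univ_product_univ, Finset.sum_product]
    rw [Fin.sum_univ_castSucc]
    simp only [Fin.sum_univ_castSucc, Fin.castSucc_lt_castSucc_iff, Fin.castSucc_lt_last, true_and,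
      Finset.sum_add_distrib]
    have h0 : ∀ i : Fin m, ¬ Fin.last m < i.castSucc := fun i => not_lt.2 (Fin.le_last _)
    simp [h0]

theorem majU_eq_sum (V : Set (Fin n × Fin n)) (w : Fin m → Fin n) : majU V w
      = ∑ i : Fin m, open Classical in
        if ∃ h : i.val + 1 < m, (w i, w ⟨i.val + 1, h⟩) ∈ V then i.val + 1 else 0 := by
  rw [majU, desU, Finset.sum_filter]

theorem majU_eq_revMaj (V : Set (Fin n × Fin n)) (w : Fin m → Fin n) :
    majU V w = revMaj V (revWord w) := by
  classical
  induction m with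
  | zero => simp [revWord, revMaj, majU, desU]
  | succ m ih =>
    cases m with
    | zero =>
      rw [revWord_succ, majU_eq_sum, Finset.sum_eq_zero]
      · simp [revWord, revMaj]
      · exact fun i _ => if_neg fun ⟨h, _⟩ => by omega
    | succ m =>
      rw [revWord_succ, revWord_succ, revMaj, ← revWord_succ (fun i => w i.castSucc), ← ih,
        majU_eq_sum, majU_eq_sum, Fin.sum_univ_castSucc, Fin.sum_univ_castSucc,
        Fin.sum_univ_castSucc (n := m)]
      simp only [length_revWord]
      have e1 : ∀ i : Fin m, (∃ h : i.castSucc.castSucc.val + 1 < m + 1 + 1,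
          (w i.castSucc.castSucc, w ⟨i.castSucc.castSucc.val + 1, h⟩) ∈ V) ↔
          ∃ h : i.castSucc.val + 1 < m + 1,
          (w i.castSucc.castSucc, w (Fin.castSucc ⟨i.castSucc.val + 1, h⟩)) ∈ V := by
        intro i
        have := i.2
        constructor
        · rintro ⟨h, hV⟩
          exact ⟨by simp, hV⟩
        · rintro ⟨h, hV⟩
          exact ⟨by simp, hV⟩
      simp only [e1]
      have e2 : (⟨m + 1, by omega⟩ : Fin (m + 1 + 1)) = Fin.last (m + 1) := rfl
      simp [e2]

/-- `inv'_V` and `maj'_V` are equidistributed if `V` is a strict weak order on the letters. -/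
theorem equidistributed_inv_maj (α : Fin n → ℕ) (V : Set (Fin n × Fin n))
    (h1 : ∀ c u x, 0 < α c → 0 < α u → 0 < α x → (c, x) ∈ V → (u, x) ∉ V →
      (c, u) ∈ V ∧ (u, c) ∉ V) :
    Equidistributed (rearrangements α) (invU V) (majU V) := by
  have hT : ∀ w ∈ rearrangements α, ∀ u ∈ revWord w, 0 < α u := by
    intro w hw u hu
    rw [← hw u, card_eq_count_ofFn]
    exact List.count_pos_iff.2 (by simpa [revWord] using hu)
  have hF : ∀ w : Fin (∑ x, α x) → Fin n, ∃ v : Fin (∑ x, α x) → Fin n,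
      revWord v = foata V (revWord w) := by
    intro w
    obtain ⟨v, hv⟩ := exists_ofFn_eq (m := ∑ x, α x) (l := (foata V (revWord w)).reverse)
      (by rw [List.length_reverse, (foata_perm _).length_eq, length_revWord])
    exact ⟨v, by rw [revWord, hv, List.reverse_reverse]⟩
  choose F hF using hF
  have hcard : ∀ w x, (Finset.univ.filter (fun i => F w i = x)).card
      = (Finset.univ.filter (fun i => w i = x)).card := by
    intro w x
    rw [card_eq_count_ofFn, card_eq_count_ofFn, ← List.count_reverse, ← List.count_reverse
      (l := List.ofFn w)]
    have := (foata_perm (V := V) (revWord w)).count_eq x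
    rw [← hF] at this
    exact this
  have hinj : Function.Injective F := fun v w h =>
    revWord_injective (foata_injective (V := V) (by rw [← hF, ← hF, h]))
  have hstat : ∀ w ∈ rearrangements α, invU V (F w) = majU V w := by
    intro w hw
    rw [invU_eq_revInv, majU_eq_revMaj, hF]
    exact revInv_foata (T := {u | 0 < α u}) (fun c hc u hu x hx => h1 c u x hc hu hx) _ (hT w hw)
  have hmem : ∀ w, F w ∈ rearrangements α ↔ w ∈ rearrangements α := by
    intro w
    simp only [rearrangements, Set.mem_ofPred_eq, hcard]
  intro k
  refine (Set.ncard_congr (fun w _ => F w) ?_ (fun v w _ _ h => hinj h) ?_).symm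
  · rintro w ⟨hw, hk⟩
    exact ⟨(hmem w).2 hw, by rw [hstat w hw, hk]⟩
  · rintro v ⟨hv, hk⟩
    obtain ⟨w, rfl⟩ := Finite.surjective_of_injective hinj v
    have hw := (hmem w).1 hv
    exact ⟨w, ⟨hw, by rw [← hstat w hw, hk]⟩, rfl⟩

/-! ### Words with the largest possible sorting index -/

/-- No pair of positions `i < j` carries a pair of `V` in the wrong order. -/
def Desc (V : Set (Fin n × Fin n)) (v : Fin m → Fin n) : Prop := ∀ i j, i < j → (v j, v i) ∉ V

open Classical in
/-- The number of letters of `v` that are not `V`-below `a`. -/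
noncomputable def nonBelow (V : Set (Fin n × Fin n)) (a : Fin n) (v : Fin m → Fin n) : ℕ :=
  (Finset.univ.filter fun h => (a, v h) ∉ V).card

/-- Every word with the letters of `u` that is carried to a word without wrongly ordered pairs
attains the largest possible sorting index. -/
def MaxReflecting (V : Set (Fin n × Fin n)) (u : Fin m → Fin n) : Prop :=
  ∀ w : Fin m → Fin n, (∀ x, cnt w x = cnt u x) → Desc V (sortToInv m w) →
    sorU V m w = offPairs V w

/-- `V` is compatible with the order and negatively transitive on the letters in `S`. -/
structure DescWeakOrder (V : Set (Fin n × Fin n)) (S : Set (Fin n)) : Prop where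
  lt : ∀ {x y}, (x, y) ∈ V → y < x
  neg : ∀ {x y z}, x ∈ S → y ∈ S → z ∈ S → (x, z) ∈ V → (x, y) ∈ V ∨ (y, z) ∈ V

theorem lt_card_filter_iff {p : Fin m → Prop} [DecidablePred p]
    (hp : ∀ i j, i ≤ j → p j → p i) (h : Fin m) : h.val < (Finset.univ.filter p).card ↔ p h := by
  constructor
  · intro hlt
    by_contra hn
    have hsub : Finset.univ.filter p ⊆ Finset.Iio h := by
      intro i hi
      rw [Finset.mem_filter] at hi
      rw [Finset.mem_Iio]
      by_contra hi'
      exact hn (hp _ _ (not_lt.1 hi') hi.2)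
    have := Finset.card_le_card hsub
    rw [Fin.card_Iio] at this
    omega
  · intro hh
    have hsub : Finset.Iic h ⊆ Finset.univ.filter p := by
      intro i hi
      rw [Finset.mem_Iic] at hi
      exact Finset.mem_filter.2 ⟨Finset.mem_univ _, hp _ _ hi hh⟩
    have := Finset.card_le_card hsub
    rw [Fin.card_Iic] at this
    omega

theorem le_card_filter {p : Fin m → Prop} [DecidablePred p] {j : Fin (m + 1)}
    (hp : ∀ h : Fin m, h.castSucc < j → p h) : j.val ≤ (Finset.univ.filter p).card := by
  have hj := Nat.lt_succ_iff.1 j.2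
  have := Finset.card_le_card (s := Finset.univ.map (Fin.castLEEmb hj))
    (t := Finset.univ.filter p) (by
      intro i hi
      obtain ⟨k, -, rfl⟩ := Finset.mem_map.1 hi
      exact Finset.mem_filter.2 ⟨Finset.mem_univ _, hp _ (by simp [Fin.lt_def])⟩)
  simpa using this

theorem nonBelow_congr {V : Set (Fin n × Fin n)} (a : Fin n) {v w : Fin m → Fin n}
    (h : ∀ x, cnt v x = cnt w x) : nonBelow V a v = nonBelow V a w := by
  classical
  obtain ⟨σ, rfl⟩ := exists_perm_of_cnt_eq h
  rw [nonBelow, nonBelow, Finset.card_filter, Finset.card_filter]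
  exact Equiv.sum_comp σ (fun i => if (a, w i) ∉ V then 1 else 0)

theorem nonBelow_le (V : Set (Fin n × Fin n)) (a : Fin n) (v : Fin m → Fin n) :
    nonBelow V a v ≤ m := by
  classical
  exact (Finset.card_filter_le _ _).trans (by simp)

theorem mem_of_cnt_eq {S : Set (Fin n)} {v w : Fin m → Fin n} (h : ∀ x, cnt v x = cnt w x)
    (hw : ∀ i, w i ∈ S) (i : Fin m) : v i ∈ S := by
  obtain ⟨k, hk⟩ := cnt_pos_iff.1 (h (v i) ▸ cnt_pos_iff.2 ⟨i, rfl⟩ : 0 < cnt w (v i))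
  rw [← hk]
  exact hw k

/-- If `v j` is not below `a` and an earlier `v i` is, negative transitivity puts `v j` above `v i`,
a wrongly ordered pair. So the letters not below `a` form an initial segment. -/
theorem Desc.lt_nonBelow_iff {V : Set (Fin n × Fin n)} {S : Set (Fin n)} (hV : DescWeakOrder V S)
    {a : Fin n} (ha : a ∈ S) {v : Fin m → Fin n} (hv : ∀ i, v i ∈ S) (hd : Desc V v)
    (h : Fin m) : h.val < nonBelow V a v ↔ (a, v h) ∉ V := by
  classical
  refine lt_card_filter_iff (p := fun h => (a, v h) ∉ V) (fun i j hij hj hi => ?_) h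
  rcases hij.eq_or_lt with rfl | hlt
  · exact hj hi
  · rcases hV.neg ha (hv j) (hv i) hi with h1 | h1
    · exact hj h1
    · exact hd i j hlt h1

theorem desc_insertNth {V : Set (Fin n × Fin n)} {S : Set (Fin n)} (hV : DescWeakOrder V S)
    {a : Fin n} {v : Fin m → Fin n} {j : Fin (m + 1)} (hd : Desc V v) (ha : ∀ i, v i ≤ a)
    (hj : ∀ h : Fin m, h.castSucc < j → (a, v h) ∉ V) :
    Desc V (Fin.insertNth (α := fun _ => Fin n) j a v) := by
  intro i k hik
  rcases Fin.eq_self_or_eq_succAbove j i with hi | ⟨i, rfl⟩ <;>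
    rcases Fin.eq_self_or_eq_succAbove j k with hk | ⟨k, rfl⟩
  · exact absurd (hi.trans hk.symm) hik.ne
  · rw [hi, Fin.insertNth_apply_same, Fin.insertNth_apply_succAbove]
    exact fun h => absurd (hV.lt h) (not_lt.2 (ha k))
  · rw [hk] at hik ⊢
    rw [Fin.insertNth_apply_same, Fin.insertNth_apply_succAbove]
    exact hj i ((Fin.succAbove_lt_iff_castSucc_lt _ _).1 hik)
  · rw [Fin.insertNth_apply_succAbove, Fin.insertNth_apply_succAbove]
    exact hd i k (Fin.succAbove_lt_succAbove_iff.1 hik)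

theorem offPairs_sortStep_of_lt {V : Set (Fin n × Fin n)} (hV : ∀ {x y}, (x, y) ∈ V → y < x)
    (w : Fin (m + 1) → Fin n) : offPairs V w = offPairs V (sortStep w)
      + ∑ h, ind V (w (lastMaxPos w)) (sortStep w h) := by
  rw [offPairs_sortStep, Finset.sum_eq_zero (s := Finset.univ)
    (f := fun h => ind V (sortStep w h) (w (lastMaxPos w))), add_zero]
  exact fun h _ => ind_eq_zero fun hh => absurd (hV hh) (not_lt.2 (sortStep_le w h))

theorem sorU_eq_offPairs_succ {V : Set (Fin n × Fin n)} (hV : ∀ {x y}, (x, y) ∈ V → y < x)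
    {w : Fin (m + 1) → Fin n} (h : sorU V (m + 1) w = offPairs V w) :
    sorU V m (sortStep w) = offPairs V (sortStep w) ∧
      ∀ i : Fin m, i.castSucc < lastMaxPos w → (w (lastMaxPos w), sortStep w i) ∉ V := by
  rw [sorU_succ, offPairs_sortStep_of_lt hV] at h
  have h1 := sorU_le_offPairs V m (sortStep w)
  have h2 := below_le_sum V (w (lastMaxPos w)) (lastMaxPos w) (sortStep w)
  exact ⟨by omega, below_eq_sum (by omega)⟩

/-- A word with the largest possible sorting index is carried to a word without wrongly ordered
pairs. -/
theorem desc_sortToInv {V : Set (Fin n × Fin n)} {S : Set (Fin n)} (hV : DescWeakOrder V S) :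
    ∀ (m : ℕ) (w : Fin m → Fin n), (∀ i, w i ∈ S) → sorU V m w = offPairs V w →
      Desc V (sortToInv m w)
  | 0, _, _, _ => fun i => i.elim0
  | m + 1, w, hw, h => by
      classical
      obtain ⟨h1, h2⟩ := sorU_eq_offPairs_succ hV.lt h
      have hs : ∀ i, sortStep w i ∈ S := fun i => hw _
      have hd := desc_sortToInv hV m (sortStep w) hs h1
      refine desc_insertNth hV hd (sortToInv_le (sortStep_le w)) fun i hi => ?_
      rw [← hd.lt_nonBelow_iff hV (hw _) (mem_of_cnt_eq (cnt_sortToInv m _) hs),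
        nonBelow_congr _ (cnt_sortToInv m _)]
      -- All letters before the insertion point were not below the moved letter, so that point does
      -- not exceed the number of such letters, which form an initial segment of the image.
      exact lt_of_lt_of_le hi (le_card_filter h2)

/-- Putting the largest letter back in front of everything below it gives a word to which the
hypothesis applies. Maximality then holds in both summands of the recursion: for the remaining word,
and for the letters below the largest one, none of which may precede the insertion point. -/
theorem MaxReflecting.step {V : Set (Fin n × Fin n)} {S : Set (Fin n)} (hV : DescWeakOrder V S)
    {u : Fin (m + 1) → Fin n} (hu : ∀ i, u i ∈ S) (hR : MaxReflecting V u) :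
    MaxReflecting V (sortStep u) ∧ ∀ w : Fin m → Fin n, (∀ x, cnt w x = cnt (sortStep u) x) →
      Desc V (sortToInv m w) →
      ∀ h : Fin m, h.val < nonBelow V (u (lastMaxPos u)) w → (u (lastMaxPos u), w h) ∉ V := by
  have key : ∀ w : Fin m → Fin n, (∀ x, cnt w x = cnt (sortStep u) x) →
      Desc V (sortToInv m w) → sorU V m w = offPairs V w ∧
      ∀ h : Fin m, h.val < nonBelow V (u (lastMaxPos u)) w → (u (lastMaxPos u), w h) ∉ V := by
    intro w hw hd
    set a := u (lastMaxPos u) with ha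
    -- In the image of `w` the letters before this position are exactly those not below `a`, so
    -- inserting `a` here creates no wrongly ordered pair.
    let j : Fin (m + 1) := ⟨nonBelow V a w, Nat.lt_succ_of_le (nonBelow_le V a w)⟩
    have hwS : ∀ i, w i ∈ S := mem_of_cnt_eq hw fun i => hu _
    have hwa : ∀ i, w i ≤ a := mem_of_cnt_eq (S := Set.Iic a) hw fun i => sortStep_le u i
    have hiff : ∀ h : Fin m, h.castSucc < j ↔ (a, sortToInv m w h) ∉ V := by
      intro h
      rw [← hd.lt_nonBelow_iff hV (hu _) (mem_of_cnt_eq (cnt_sortToInv m _) hwS),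
        nonBelow_congr _ (cnt_sortToInv m _)]
      rfl
    have hpos : ∀ h, w h = a → h.castSucc < j := by
      intro h hh
      rw [hiff, (sortToInv_eq_iff m w a hwa h).2 hh]
      exact fun h => absurd (hV.lt h) (lt_irrefl _)
    have hl := lastMaxPos_unsort hwa hpos
    have hs := sortStep_unsort hwa hpos
    have hm := hR (unsort j a w) (fun x => by rw [cnt_unsort, hw, cnt_sortStep u]) (by
      rw [sortToInv, hl, hs, unsort_apply_self]
      exact desc_insertNth hV hd (sortToInv_le hwa) fun h => (hiff h).1)
    have := sorU_eq_offPairs_succ hV.lt hm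
    rw [hl, hs, unsort_apply_self] at this
    exact this
  exact ⟨fun w hw hd => (key w hw hd).1, fun w hw hd => (key w hw hd).2⟩

theorem exists_antitone (u : Fin m → Fin n) :
    ∃ v : Fin m → Fin n, Antitone v ∧ ∀ x, cnt v x = cnt u x := by
  refine ⟨u ∘ Tuple.sort (fun i => OrderDual.toDual (u i)), ?_, cnt_comp_perm u _⟩
  exact fun i j hij => Tuple.monotone_sort (fun i => OrderDual.toDual (u i)) hij

/-- Otherwise `a`, `a'` and `y` are incomparable. Inserting `a'` right after its own copies, but
before the end of its block, makes the inverse interchange throw a letter of this block to the last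
position. The letter `d` below `a` then spoils the initial segment that `MaxReflecting.step`
demands. -/
theorem MaxReflecting.below_of_ne {V : Set (Fin n × Fin n)} {S : Set (Fin n)}
    (hV : DescWeakOrder V S) {u : Fin (m + 2) → Fin n} (hu : ∀ i, u i ∈ S)
    (hR : MaxReflecting V u) {a a' : Fin n} (ha : u (lastMaxPos u) = a)
    (ha' : sortStep u (lastMaxPos (sortStep u)) = a') (haa : (a, a') ∉ V) {d y : Fin n}
    (hd : 0 < cnt (sortStep (sortStep u)) d) (had : (a, d) ∈ V)
    (hy : 0 < cnt (sortStep (sortStep u)) y) (hya : y ≠ a') : (a, y) ∈ V := by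
  classical
  by_contra hay
  obtain ⟨hR1, tidy1⟩ := hR.step hV hu
  have hu1 : ∀ i, sortStep u i ∈ S := fun i => hu _
  obtain ⟨-, tidy2⟩ := hR1.step hV hu1
  rw [ha] at tidy1
  rw [ha'] at tidy2
  have hle : ∀ i, sortStep (sortStep u) i ≤ a' := fun i => ha' ▸ sortStep_le _ i
  have haa' : a' ≤ a := ha ▸ ha' ▸ sortStep_le u _
  -- A decreasing image has no wrongly ordered pair and begins with all copies of `a'`.
  obtain ⟨v, hva, hvc⟩ := exists_antitone (sortStep (sortStep u))
  obtain ⟨w, rfl⟩ := sortToInv_surjective m v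
  have hwc : ∀ x, cnt w x = cnt (sortStep (sortStep u)) x := fun x => by
    rw [← cnt_sortToInv, hvc]
  have hdesc : Desc V (sortToInv m w) := fun i j hij h =>
    absurd (hV.lt h) (not_lt.2 (hva hij.le))
  have hwS : ∀ i, w i ∈ S := mem_of_cnt_eq hwc fun i => hu1 _
  have hvS : ∀ i, sortToInv m w i ∈ S := mem_of_cnt_eq hvc fun i => hu1 _
  have hwa : ∀ i, w i ≤ a' := mem_of_cnt_eq (S := Set.Iic a') hwc hle
  have haS : a ∈ S := ha ▸ hu _
  have haS' : a' ∈ S := ha' ▸ hu1 _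
  have hyS : y ∈ S := by
    obtain ⟨i, rfl⟩ := cnt_pos_iff.1 hy
    exact hu1 _
  have hay' : (a', y) ∉ V := fun h => by
    rcases hV.neg haS' haS hyS h with h | h
    · exact absurd (hV.lt h) (not_lt.2 haa')
    · exact hay h
  have hposa : ∀ h : Fin m, h.val < cnt w a' ↔ w h = a' := by
    intro h
    rw [← sortToInv_eq_iff m w a' hwa, ← cnt_sortToInv m w, cnt]
    refine lt_card_filter_iff (p := fun i => sortToInv m w i = a') (fun i j hij hj => ?_) h
    exact le_antisymm (sortToInv_le hwa i) (hj ▸ hva hij)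
  have hlt : cnt w a' < nonBelow V a' w := by
    refine Finset.card_lt_card ((Finset.ssubset_iff_of_subset ?_).2 ?_)
    · intro i hi
      rw [Finset.mem_filter] at hi ⊢
      refine ⟨Finset.mem_univ _, ?_⟩
      rw [hi.2]
      exact fun h => absurd (hV.lt h) (lt_irrefl _)
    · obtain ⟨i, hi⟩ := cnt_pos_iff.1 ((hwc y).symm ▸ hy)
      refine ⟨i, Finset.mem_filter.2 ⟨Finset.mem_univ _, by rwa [hi]⟩, fun h => ?_⟩
      rw [Finset.mem_filter, hi] at h
      exact hya h.2
  have hjm : cnt w a' < m := lt_of_lt_of_le hlt (nonBelow_le V a' w)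
  -- The first position after the copies of `a'`; by `hlt` its letter still belongs to those not
  -- below `a'`.
  let j : Fin m := ⟨cnt w a', hjm⟩
  have hpos : ∀ h, w h = a' → h.castSucc < j.castSucc := fun h hh => (hposa h).2 hh
  have hl := lastMaxPos_unsort hwa hpos
  have hs := sortStep_unsort hwa hpos
  have hc : ∀ x, cnt (unsort j.castSucc a' w) x = cnt (sortStep u) x := fun x => by
    rw [cnt_unsort, hwc, cnt_sortStep (sortStep u), ha']
  have hD : Desc V (sortToInv (m + 1) (unsort j.castSucc a' w)) := by
    rw [sortToInv, hl, hs, unsort_apply_self]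
    refine desc_insertNth hV hdesc (sortToInv_le hwa) fun h hh => ?_
    rw [← hdesc.lt_nonBelow_iff hV haS' hvS, nonBelow_congr _ (cnt_sortToInv m _)]
    exact lt_trans hh hlt
  have ht := tidy1 _ hc hD
  have hlast : unsort j.castSucc a' w (Fin.last m) = w j := by
    simp [unsort]
  have hwj : (a', w j) ∉ V := tidy2 w hwc hdesc j hlt
  have hawj : (a, w j) ∉ V := fun h => by
    rcases hV.neg haS haS' (hwS j) h with h | h
    · exact haa h
    · exact hwj h
  have hcard : nonBelow V a (unsort j.castSucc a' w) ≤ m := by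
    rw [nonBelow, ← Nat.lt_succ_iff]
    refine lt_of_lt_of_eq (Finset.card_lt_card (Finset.filter_ssubset.2 ?_)) (Finset.card_fin _)
    obtain ⟨i, hi⟩ := cnt_pos_iff.1 (show 0 < cnt (unsort j.castSucc a' w) d by
      rw [hc, cnt_sortStep]; omega)
    exact ⟨i, Finset.mem_univ _, by rw [hi, not_not]; exact had⟩
  -- The initial segment already contains as many positions as there are letters not below `a`, and
  -- the last position would be one more.
  have hsub : (Finset.univ.filter fun h : Fin (m + 1) => h.val < nonBelow V a (unsort j.castSucc a' w))
      ⊂ Finset.univ.filter fun h => (a, unsort j.castSucc a' w h) ∉ V := by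
    refine (Finset.ssubset_iff_of_subset fun h hh => ?_).2 ⟨Fin.last m, ?_, ?_⟩
    · rw [Finset.mem_filter] at hh ⊢
      exact ⟨hh.1, ht h hh.2⟩
    · rw [Finset.mem_filter, hlast]
      exact ⟨Finset.mem_univ _, hawj⟩
    · rw [Finset.mem_filter]
      exact fun h => absurd h.2 (not_lt.2 hcard)
  have := Finset.card_lt_card hsub
  have h2 := le_card_filter (m := m + 1) (j := ⟨nonBelow V a (unsort j.castSucc a' w), by omega⟩)
    (p := fun h : Fin (m + 1) => h.val < nonBelow V a (unsort j.castSucc a' w)) (fun h hh => hh)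
  exact absurd this (not_lt.2 h2)

/-! ### Small blocks: necessity and sufficiency for the sorting index -/

/-- A letter `b` above some letter that is comparable to neither itself nor another letter `y < b`
occurs once, and no larger letter is incomparable to `b`. -/
def SmallBlocks (V : Set (Fin n × Fin n)) (α : Fin n → ℕ) : Prop :=
  ∀ y b d, 0 < α y → 0 < α b → 0 < α d → y < b → (b, y) ∉ V → (b, d) ∈ V →
    α b ≤ 1 ∧ ∀ a, 0 < α a → b < a → (a, b) ∈ V

/-- Induction by removing the largest letter: only the two largest occurrences need to be compared
with `b`, and `MaxReflecting.below_of_ne` excludes the bad case. -/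
theorem MaxReflecting.smallBlocks {V : Set (Fin n × Fin n)} {S : Set (Fin n)}
    (hV : DescWeakOrder V S) : ∀ (m : ℕ) (u : Fin m → Fin n), (∀ i, u i ∈ S) →
    MaxReflecting V u → SmallBlocks V (cnt u)
  | 0, u, _, _ => fun y b d hy => by
      obtain ⟨i, -⟩ := cnt_pos_iff.1 hy
      exact i.elim0
  | m + 1, u, hu, hR => by
      intro y b d hy hb hd hyb hVy hVd
      have hu1 : ∀ i, sortStep u i ∈ S := fun i => hu _
      have ih := MaxReflecting.smallBlocks hV m (sortStep u) hu1 (hR.step hV hu).1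
      have hmem : ∀ {x}, 0 < cnt u x → x ∈ S ∧ x ≤ u (lastMaxPos u) := fun {x} hx => by
        obtain ⟨i, rfl⟩ := cnt_pos_iff.1 hx
        exact ⟨hu i, le_lastMaxPos u i⟩
      have hdb := hV.lt hVd
      have hb1 := (hmem hb).2
      have hsame : ∀ x, x < u (lastMaxPos u) → cnt (sortStep u) x = cnt u x := fun x hx => by
        rw [cnt_sortStep u, if_neg hx.ne', add_zero]
      -- If a copy of `b` survives the removal of the largest letter `a` and `a` is not above `b`,
      -- then neither is `a` above the next largest letter `a'`, while `y` stays incomparable to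
      -- `a`.
      have two : 0 < cnt (sortStep u) b → (u (lastMaxPos u), b) ∉ V → False := by
        intro hb2 hab
        cases m with
        | zero => obtain ⟨i, -⟩ := cnt_pos_iff.1 hb2; exact i.elim0
        | succ m =>
        set a := u (lastMaxPos u) with ha
        set a' := sortStep u (lastMaxPos (sortStep u)) with ha'
        have hba' : b ≤ a' := by
          obtain ⟨i, rfl⟩ := cnt_pos_iff.1 hb2
          exact le_lastMaxPos _ i
        have hsame2 : ∀ x, x < a' → cnt (sortStep (sortStep u)) x = cnt (sortStep u) x :=
          fun x hx => by rw [cnt_sortStep (sortStep u), if_neg hx.ne', add_zero]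
        have haa : (a, a') ∉ V := fun h => by
          rcases hV.neg (hu _) (hmem hb).1 (hu1 _) h with h | h
          · exact hab h
          · exact absurd (hV.lt h) (not_lt.2 hba')
        have had : (a, d) ∈ V := by
          rcases hV.neg (hmem hb).1 (hu (lastMaxPos u)) (hmem hd).1 hVd with h | h
          · exact absurd (hV.lt h) (not_lt.2 hb1)
          · exact h
        have hay : (a, y) ∉ V := fun h => by
          rcases hV.neg (hu _) (hmem hb).1 (hmem hy).1 h with h | h
          · exact hab h
          · exact hVy h
        have hd2 : 0 < cnt (sortStep (sortStep u)) d := by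
          rw [hsame2 d (hdb.trans_le hba'), hsame d (hdb.trans_le hb1)]; exact hd
        have hy2 : 0 < cnt (sortStep (sortStep u)) y := by
          rw [hsame2 y (hyb.trans_le hba'), hsame y (hyb.trans_le hb1)]; exact hy
        exact hay (hR.below_of_ne hV hu rfl rfl haa hd2 had hy2 (hyb.trans_le hba').ne)
      have hirr : (b, b) ∉ V := fun h => lt_irrefl _ (hV.lt h)
      rcases hb1.eq_or_lt with hb2 | hb2
      · refine ⟨?_, fun a ha hba => absurd (hmem ha).2 (not_le.2 (hb2 ▸ hba))⟩
        by_contra hlt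
        refine two ?_ (by rwa [← hb2])
        rw [cnt_sortStep u] at hlt
        split_ifs at hlt <;> omega
      · obtain ⟨h1, h2⟩ := ih y b d ((hsame y (hyb.trans hb2)).symm ▸ hy) ((hsame b hb2).symm ▸ hb)
          ((hsame d (hdb.trans hb2)).symm ▸ hd) hyb hVy hVd
        refine ⟨hsame b hb2 ▸ h1, fun a ha hba => ?_⟩
        rcases (hmem ha).2.eq_or_lt with ha2 | ha2
        · by_contra hab
          exact two ((hsame b hb2).symm ▸ hb) (ha2 ▸ hab)
        · exact h2 a ((hsame a ha2).symm ▸ ha) hba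

/-- Both recursions count letters below `a` from the same position on. The counts agree because
either nothing is below `a`, or the letters not below `a` are copies of a single letter, at least as
large as all others left, whose positions `sortToInv` keeps. -/
theorem sorU_eq_invU_sortToInv {V : Set (Fin n × Fin n)} {S : Set (Fin n)}
    (hV : DescWeakOrder V S) : ∀ (m : ℕ) (w : Fin m → Fin n), (∀ i, w i ∈ S) →
    SmallBlocks V (cnt w) → sorU V m w = invU V (sortToInv m w)
  | 0, _, _, _ => by rw [invU_eq_sum]; simp [sorU]
  | m + 1, w, hw, hB => by
      have hs : ∀ i, sortStep w i ∈ S := fun i => hw _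
      have hcle : ∀ x, cnt (sortStep w) x ≤ cnt w x := fun x => by
        rw [cnt_sortStep w]; omega
      have hB' : SmallBlocks V (cnt (sortStep w)) := by
        intro y b d hy hb hd hyb h1 h2
        obtain ⟨h3, h4⟩ := hB y b d (hy.trans_le (hcle _)) (hb.trans_le (hcle _))
          (hd.trans_le (hcle _)) hyb h1 h2
        exact ⟨(hcle _).trans h3, fun a ha => h4 a (ha.trans_le (hcle _))⟩
      rw [sorU_succ, sortToInv, invU_insertNth, sorU_eq_invU_sortToInv hV m _ hs hB',
        Finset.sum_eq_zero (s := Finset.univ) (f := fun h : Fin m =>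
          if h.castSucc < lastMaxPos w then ind V (sortToInv m (sortStep w) h) (w (lastMaxPos w))
          else 0), add_zero, add_comm]
      swap
      · intro h _
        split_ifs
        · exact ind_eq_zero fun hh => absurd (hV.lt hh)
            (not_lt.2 (sortToInv_le (sortStep_le w) h))
        · rfl
      congr 1
      set a := w (lastMaxPos w) with ha
      have haS : a ∈ S := hw _
      have hvS := mem_of_cnt_eq (cnt_sortToInv m (sortStep w)) hs
      have hva := sortToInv_le (sortStep_le w)
      by_cases hd : ∃ k, (a, sortStep w k) ∈ V
      swap
      · have hd' : ∀ k, sortStep w k ∈ {x | (a, x) ∉ V} := fun k hk => hd ⟨k, hk⟩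
        refine below_congr fun i _ => iff_of_false (fun h => hd ⟨i, h⟩) ?_
        exact mem_of_cnt_eq (cnt_sortToInv m (sortStep w)) hd' i
      obtain ⟨k, hk⟩ := hd
      have hpos : ∀ i : Fin m, 0 < cnt w (sortStep w i) := fun i => cnt_pos_iff.2 ⟨_, rfl⟩
      have hapos : 0 < cnt w a := cnt_pos_iff.2 ⟨_, rfl⟩
      -- The letters that are not below `a` are the occurrences of one largest letter
      have main : ∀ b : Fin n, (∀ i, sortStep w i ≤ b) → (a, b) ∉ V →
          (∀ i, (a, sortStep w i) ∉ V → sortStep w i = b) →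
          below V a (lastMaxPos w) (sortStep w)
            = below V a (lastMaxPos w) (sortToInv m (sortStep w)) := by
        intro b hle hab hall
        have hall' : ∀ i, sortToInv m (sortStep w) i ∈ {x | (a, x) ∉ V → x = b} :=
          mem_of_cnt_eq (cnt_sortToInv m (sortStep w)) hall
        refine below_congr fun i _ => not_iff_not.1 ?_
        have h1 : (a, sortStep w i) ∉ V ↔ sortStep w i = b :=
          ⟨hall i, fun h => by rwa [h]⟩
        have h2 : (a, sortToInv m (sortStep w) i) ∉ V ↔ sortToInv m (sortStep w) i = b :=
          ⟨hall' i, fun h => by rwa [h]⟩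
        rw [h1, h2, sortToInv_eq_iff m _ b hle]
      by_cases hy : ∃ i, (a, sortStep w i) ∉ V ∧ sortStep w i ≠ a
      swap
      · refine main a (sortStep_le w) (fun h => lt_irrefl _ (hV.lt h)) fun i hi => ?_
        by_contra hne
        exact hy ⟨i, hi, hne⟩
      obtain ⟨i, hai, hi⟩ := hy
      have hlt : sortStep w i < a := lt_of_le_of_ne (sortStep_le w i) hi
      -- With a smaller incomparable letter and a letter below it, `a` occurs only once, so no copy
      -- is left; `hsmall` then excludes two different letters incomparable to `a`.
      have hone := (hB _ a _ (hpos i) hapos (hpos k) hlt hai hk).1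
      have hna : ∀ l, sortStep w l ≠ a := by
        intro l hl
        have h1 : 0 < cnt (sortStep w) a := cnt_pos_iff.2 ⟨l, hl⟩
        rw [cnt_sortStep w, if_pos ha.symm] at hone
        omega
      have hclass : ∀ x y, x ∈ S → y ∈ S → x ≤ a → (a, x) ∉ V → (a, y) ∉ V → (x, y) ∉ V := by
        intro x y hx hy hxa h1 h2 h
        rcases hV.neg hx haS hy h with h | h
        · exact absurd (hV.lt h) (not_lt.2 hxa)
        · exact h2 h
      have hsmall : ∀ l l', (a, sortStep w l) ∉ V → (a, sortStep w l') ∉ V →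
          ¬ sortStep w l < sortStep w l' := by
        intro l l' h1 h2 hll
        have h3 : (sortStep w l', sortStep w k) ∈ V := by
          rcases hV.neg haS (hs l') (hs k) hk with h | h
          · exact absurd h h2
          · exact h
        have h4 := (hB _ _ _ (hpos l) (hpos l') (hpos k) hll
          (hclass _ _ (hs _) (hs _) (sortStep_le w _) h2 h1) h3).2 a hapos
          (lt_of_le_of_ne (sortStep_le w _) (hna _))
        exact h2 h4
      have huniq : ∀ l, (a, sortStep w l) ∉ V → sortStep w l = sortStep w i := fun l hl =>
        le_antisymm (not_lt.1 (hsmall i l hai hl)) (not_lt.1 (hsmall l i hl hai))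
      refine main _ (fun l => ?_) hai huniq
      by_contra hlt'
      have hal : (a, sortStep w l) ∈ V := by
        by_contra hal
        exact hlt' (huniq l hal).le
      rcases hV.neg haS (hs i) (hs l) hal with h | h
      · exact hai h
      · exact hlt' (hV.lt h).le

/-! ### Reduction to pairs at different positions -/

theorem invU_congr {V V' : Set (Fin n × Fin n)} {w : Fin m → Fin n}
    (h : ∀ i j, i < j → ((w i, w j) ∈ V ↔ (w i, w j) ∈ V')) : invU V w = invU V' w := by
  rw [invU_eq_sum, invU_eq_sum]
  refine Finset.sum_congr rfl fun i _ => Finset.sum_congr rfl fun j _ => ?_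
  split_ifs with hij
  · exact ind_congr (h i j hij)
  · rfl

theorem majU_congr {V V' : Set (Fin n × Fin n)} {w : Fin m → Fin n}
    (h : ∀ i j, i < j → ((w i, w j) ∈ V ↔ (w i, w j) ∈ V')) : majU V w = majU V' w := by
  rw [majU_eq_sum, majU_eq_sum]
  refine Finset.sum_congr rfl fun i _ => ?_
  have hiff : (∃ hi : i.val + 1 < m, (w i, w ⟨i.val + 1, hi⟩) ∈ V) ↔
      ∃ hi : i.val + 1 < m, (w i, w ⟨i.val + 1, hi⟩) ∈ V' :=
    exists_congr fun hi => h i ⟨i.val + 1, hi⟩ (Nat.lt_succ_self _)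
  by_cases hi : ∃ hi : i.val + 1 < m, (w i, w ⟨i.val + 1, hi⟩) ∈ V
  · rw [if_pos hi, if_pos (hiff.1 hi)]
  · rw [if_neg hi, if_neg (mt hiff.2 hi)]

theorem cnt_of_mem {α : Fin n → ℕ} {w : Fin (∑ x, α x) → Fin n} (hw : w ∈ rearrangements α) :
    cnt w = α := funext hw

theorem mem_occurring {α : Fin n → ℕ} {x : Fin n} : x ∈ occurring α ↔ 0 < α x := by
  simp [occurring, Nat.succ_le_iff]

theorem apply_mem_occurring {α : Fin n → ℕ} {w : Fin (∑ x, α x) → Fin n}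
    (hw : w ∈ rearrangements α) (i) : w i ∈ occurring α := by
  rw [mem_occurring, ← cnt_of_mem hw]
  exact cnt_pos_iff.2 ⟨i, rfl⟩

/-- Equal letters at two positions have multiplicity at least 2, so the diagonal pairs dropped by
`reduced` cannot occur here. -/
theorem mem_reduced_iff_of_ne {α : Fin n → ℕ} (U : Set (Fin n × Fin n))
    {w : Fin (∑ x, α x) → Fin n} (hw : w ∈ rearrangements α) {i j} (hij : i ≠ j) :
    (w i, w j) ∈ U ↔ (w i, w j) ∈ reduced α U := by
  refine ⟨fun h => ⟨h, apply_mem_occurring hw i, apply_mem_occurring hw j, ?_⟩, fun h => h.1⟩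
  rintro ⟨h1, h2⟩
  simp only at h1 h2
  have h3 : 1 < (Finset.univ.filter (fun k => w k = w i)).card :=
    Finset.one_lt_card.2 ⟨i, by simp, j, by simp [h1], hij⟩
  rw [hw, h2] at h3
  exact lt_irrefl _ h3

theorem Equidistributed.congr {W : Type*} {R : Set W} {f f' g g' : W → ℕ}
    (hf : ∀ w ∈ R, f w = f' w) (hg : ∀ w ∈ R, g w = g' w) (h : Equidistributed R f g) :
    Equidistributed R f' g' := by
  intro k
  have h1 : {w ∈ R | f' w = k} = {w ∈ R | f w = k} := by
    ext w
    exact and_congr_right fun hw => by rw [hf w hw]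
  have h2 : {w ∈ R | g' w = k} = {w ∈ R | g w = k} := by
    ext w
    exact and_congr_right fun hw => by rw [hg w hw]
  rw [h1, h2, h k]

theorem Equidistributed.exists_eq {W : Type*} [Finite W] {R : Set W} {f g : W → ℕ}
    (h : Equidistributed R f g) {w : W} (hw : w ∈ R) : ∃ v ∈ R, g v = f w := by
  have h1 : 0 < {v ∈ R | f v = f w}.ncard := (Set.ncard_pos (Set.toFinite _)).2 ⟨w, hw, rfl⟩
  rw [h] at h1
  obtain ⟨v, hv, hk⟩ := (Set.ncard_pos (Set.toFinite _)).1 h1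
  exact ⟨v, hv, hk⟩

theorem Equidistributed.symm {W : Type*} {R : Set W} {f g : W → ℕ}
    (h : Equidistributed R f g) : Equidistributed R g f := fun k => (h k).symm

/-! ### Existence of words and extreme values of the statistics -/

/-- The multiset of the letters of the words in a rearrangement class. -/
def letters (α : Fin n → ℕ) : Multiset (Fin n) := ∑ x, Multiset.replicate (α x) x

theorem count_letters (α : Fin n → ℕ) (x : Fin n) : (letters α).count x = α x := by
  rw [letters, Multiset.count_sum']
  simp [Multiset.count_replicate]

theorem exists_word {α : Fin n → ℕ} {l : List (Fin n)} (h : ∀ x, l.count x = α x) :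
    ∃ w ∈ rearrangements α, List.ofFn w = l := by
  have hl : l.length = ∑ x, α x := by
    rw [← Multiset.coe_card, ← Multiset.sum_count_eq_card (s := Finset.univ) (by simp)]
    exact Finset.sum_congr rfl fun x _ => by simp [h]
  obtain ⟨w, hw⟩ := exists_ofFn_eq hl
  exact ⟨w, fun x => by rw [card_eq_count_ofFn, hw, h], hw⟩

theorem rearrangements_nonempty (α : Fin n → ℕ) : (rearrangements α).Nonempty := by
  obtain ⟨w, hw, -⟩ := exists_word (α := α) (l := (letters α).toList) fun x => by
    rw [← Multiset.coe_count, Multiset.coe_toList, count_letters]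
  exact ⟨w, hw⟩

theorem sorU_eq_zero_of_monotone (V : Set (Fin n × Fin n)) : ∀ (m : ℕ) (w : Fin m → Fin n),
    Monotone w → sorU V m w = 0
  | 0, _, _ => rfl
  | m + 1, w, hw => by
      have hl : lastMaxPos w = Fin.last m :=
        lastMaxPos_eq (fun h => hw (Fin.le_last h)) fun h hh => absurd hh (not_lt.2 (Fin.le_last h))
      have hs : sortStep w = fun i => w i.castSucc := funext fun i =>
        sortStep_castSucc_lt (hl ▸ Fin.castSucc_lt_last i)
      have hm : Monotone (sortStep w) := by
        rw [hs]
        exact fun i j hij => hw (Fin.castSucc_le_castSucc_iff.2 hij)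
      rw [sorU_succ, sorU_eq_zero_of_monotone V m _ hm, below, hl, add_zero]
      exact Finset.sum_eq_zero fun i _ => if_neg (not_le.2 (Fin.castSucc_lt_last i))

theorem invU_add_invU_rev (V : Set (Fin n × Fin n)) (w : Fin m → Fin n) :
    invU V w + invU V (w ∘ Fin.rev) = offPairs V w := by
  have h : invU V (w ∘ Fin.rev) = ∑ i, ∑ j, if j < i then ind V (w i) (w j) else 0 := by
    rw [invU_eq_sum, ← Equiv.sum_comp Fin.revPerm]
    refine Finset.sum_congr rfl fun i _ => ?_
    rw [← Equiv.sum_comp Fin.revPerm]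
    simp
  rw [h, invU_eq_sum, offPairs, ← Finset.sum_add_distrib]
  refine Finset.sum_congr rfl fun i _ => ?_
  rw [← Finset.sum_add_distrib]
  refine Finset.sum_congr rfl fun j _ => ?_
  rcases lt_trichotomy i j with hij | hij | hij
  · simp [hij, hij.ne, hij.not_gt]
  · simp [hij]
  · simp [hij, hij.ne', hij.not_gt]

theorem invU_eq_zero_iff {V : Set (Fin n × Fin n)} {w : Fin m → Fin n} :
    invU V w = 0 ↔ ∀ i j, i < j → (w i, w j) ∉ V := by
  classical
  rw [invU, Finset.card_eq_zero, Finset.filter_eq_empty_iff]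
  exact ⟨fun h i j hij hV => h (Finset.mem_univ (i, j)) ⟨hij, hV⟩,
    fun h p _ hp => h p.1 p.2 hp.1 hp.2⟩

theorem invU_eq_offPairs_iff {V : Set (Fin n × Fin n)} {w : Fin m → Fin n} :
    invU V w = offPairs V w ↔ Desc V w := by
  rw [← invU_add_invU_rev, left_eq_add, invU_eq_zero_iff]
  constructor
  · intro h i j hij
    have := h (Fin.rev j) (Fin.rev i) (Fin.rev_lt_rev.2 hij)
    simpa using this
  · intro h i j hij
    exact h _ _ (Fin.rev_lt_rev.2 hij)

/-! ### Necessity of the order conditions -/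

/-- Equidistribution lets sor count all `V`-pairs of some word `u`, although it sees only the
decreasing ones. Hence `u`, in which every occurring letter appears, carries no other `V`-pairs. -/
theorem lt_of_mem_reduced {α : Fin n → ℕ} {U : Set (Fin n × Fin n)}
    (h : Equidistributed (rearrangements α) (sorU (reduced α U) (∑ x, α x))
      (invU (reduced α U))) {x y : Fin n} (hxy : (x, y) ∈ reduced α U) : y < x := by
  set V := reduced α U with hV
  obtain ⟨w0, hw0⟩ := rearrangements_nonempty α
  have hasc : w0 ∘ Tuple.sort w0 ∈ rearrangements α := fun z =>
    (cnt_comp_perm w0 _ z).trans (hw0 z)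
  obtain ⟨w1, hw1, h1⟩ := h.exists_eq hasc
  rw [sorU_eq_zero_of_monotone V _ _ (Tuple.monotone_sort w0)] at h1
  have hrev : w1 ∘ Fin.rev ∈ rearrangements α := fun z =>
    (cnt_comp_perm w1 Fin.revPerm z).trans (hw1 z)
  obtain ⟨u, hu, h2⟩ := h.symm.exists_eq hrev
  have h3 : sorU V _ u = offPairs V u := by
    rw [h2, offPairs_congr (w := w1) (fun z => by rw [cnt_of_mem hu, cnt_of_mem hw1]),
      ← invU_add_invU_rev V w1, h1, zero_add]
  let V' : Set (Fin n × Fin n) := {p | p ∈ V ∧ p.2 < p.1}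
  have h4 : offPairs V u ≤ offPairs V' u := by
    rw [← h3, sorU_congr (V' := V') _ u fun i j hij => ⟨fun hp => ⟨hp, hij⟩, fun hp => hp.1⟩]
    exact sorU_le_offPairs V' _ u
  have hle : ∀ i j, (if i = j then 0 else ind V' (u i) (u j))
      ≤ if i = j then 0 else ind V (u i) (u j) := by
    intro i j
    split_ifs
    · exact le_rfl
    · by_cases hp : (u i, u j) ∈ V'
      · rw [ind_eq_one hp, ind_eq_one hp.1]
      · rw [ind_eq_zero hp]
        exact Nat.zero_le _
  have h5 : ∀ i j, i ≠ j → (u i, u j) ∈ V → u j < u i := by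
    intro i j hij hp
    by_contra hn
    refine absurd h4 (not_le.2 (Finset.sum_lt_sum
      (fun i _ => Finset.sum_le_sum fun j _ => hle i j) ⟨i, Finset.mem_univ _,
        Finset.sum_lt_sum (fun j _ => hle i j) ⟨j, Finset.mem_univ _, ?_⟩⟩))
    rw [if_neg hij, if_neg hij, ind_eq_one hp, ind_eq_zero fun hq => hn hq.2]
    exact one_pos
  have hxy' : (x, y) ∈ V := hxy
  obtain ⟨-, hx, hy, hne⟩ := hxy
  simp only at hx hy hne
  rw [mem_occurring, ← cnt_of_mem hu] at hx hy
  by_cases he : x = y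
  · subst he
    have hlt : 1 < cnt u x := by
      rcases Nat.lt_or_ge 1 (cnt u x) with h | h
      · exact h
      · exact absurd ⟨rfl, by rw [← cnt_of_mem hu]; omega⟩ hne
    obtain ⟨i, hi, j, hj, hij⟩ := Finset.one_lt_card.1 hlt
    rw [Finset.mem_filter] at hi hj
    have := h5 i j hij (by rw [hi.2, hj.2]; exact hxy')
    rwa [hi.2, hj.2] at this
  · obtain ⟨i, rfl⟩ := cnt_pos_iff.1 hx
    obtain ⟨j, rfl⟩ := cnt_pos_iff.1 hy
    exact h5 i j (fun hij => he (by rw [hij])) hxy'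

/-- A counterexample `x, y, z` placed consecutively hides the inversion `(x, z)` from maj.
Completing the word without `V`-descents gives maj 0 and positive inv, against the equality of the
two zero sets. -/
theorem descWeakOrder_reduced {α : Fin n → ℕ} {U : Set (Fin n × Fin n)}
    (hlt : ∀ {x y}, (x, y) ∈ reduced α U → y < x)
    (h : Equidistributed (rearrangements α) (invU (reduced α U)) (majU (reduced α U))) :
    DescWeakOrder (reduced α U) (occurring α) := by
  refine ⟨hlt, ?_⟩
  intro x y z hx hy hz hxz
  set V := reduced α U with hV
  by_contra hcon
  rw [not_or] at hcon
  obtain ⟨hxy, hyz⟩ := hcon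
  have hzx := hlt hxz
  have hne1 : x ≠ y := fun he => hyz (he ▸ hxz)
  have hne2 : y ≠ z := fun he => hxy (he ▸ hxz)
  have hsub : ({w ∈ rearrangements α | invU V w = 0}) ⊆ {w ∈ rearrangements α | majU V w = 0} := by
    rintro w ⟨hw, h0⟩
    refine ⟨hw, ?_⟩
    rw [invU_eq_zero_iff] at h0
    rw [majU_eq_sum]
    exact Finset.sum_eq_zero fun i _ => if_neg fun ⟨hi, hp⟩ =>
      h0 i ⟨i.val + 1, hi⟩ (Nat.lt_succ_self _) hp
  have heq := Set.eq_of_subset_of_ncard_le hsub (h 0).ge (Set.toFinite _)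
  have hM : ({x, y, z} : Multiset (Fin n)) ≤ letters α := by
    rw [Multiset.le_iff_count]
    intro a
    rw [count_letters]
    have hx' := mem_occurring.1 hx
    have hy' := mem_occurring.1 hy
    have hz' := mem_occurring.1 hz
    simp only [Multiset.insert_eq_cons, Multiset.count_cons, Multiset.count_singleton]
    by_cases h1 : a = x
    · subst h1
      simpa [hne1, hzx.ne'] using Nat.succ_le_iff.2 hx'
    by_cases h2 : a = y
    · subst h2
      simpa [h1, hne2] using Nat.succ_le_iff.2 hy'
    by_cases h3 : a = z
    · subst h3
      simpa [h1, h2] using Nat.succ_le_iff.2 hz'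
    simp [h1, h2, h3]
  set M0 := letters α - {x, y, z} with hM0
  set l1 := (M0.filter (· ≤ x)).sort with hl1
  set l2 := (M0.filter (¬ · ≤ x)).sort with hl2
  -- The remaining letters up to `x` go in front in increasing order and those above `x` go behind;
  -- since `z < x`, neither junction is a `V`-descent.
  obtain ⟨w, hw, hwl⟩ := exists_word (α := α) (l := l1 ++ x :: y :: z :: l2) (by
    intro a
    rw [← count_letters α a, ← Multiset.coe_count]
    congr 1
    rw [← Multiset.sub_add_cancel hM, ← hM0, ← Multiset.filter_add_not (· ≤ x) M0,
      ← Multiset.coe_add, ← Multiset.cons_coe, ← Multiset.cons_coe, ← Multiset.cons_coe,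
      hl1, hl2, Multiset.sort_eq, Multiset.sort_eq]
    simp only [Multiset.insert_eq_cons, ← Multiset.singleton_add]
    abel)
  have hchain : (List.ofFn w).IsChain (fun a b => (a, b) ∉ V) := by
    have hasc : ∀ s : Multiset (Fin n), s.sort.IsChain (fun a b => (a, b) ∉ V) := fun s =>
      ((Multiset.pairwise_sort s (· ≤ ·)).imp fun {a b} hab hp =>
        absurd (hlt hp) (not_lt.2 hab)).isChain
    rw [hwl, List.isChain_append, List.isChain_cons_cons, List.isChain_cons_cons, List.isChain_cons]
    refine ⟨hasc _, ⟨hxy, hyz, fun a ha hp => ?_, hasc _⟩, fun a ha b hb hp => ?_⟩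
    · have ha' : a ∈ l2 := List.mem_of_mem_head? ha
      rw [hl2, Multiset.mem_sort, Multiset.mem_filter] at ha'
      exact ha'.2 ((hlt hp).trans hzx).le
    · have ha' : a ∈ l1 := List.mem_of_mem_getLast? ha
      rw [hl1, Multiset.mem_sort, Multiset.mem_filter] at ha'
      simp only [List.head?_cons, Option.mem_def, Option.some.injEq] at hb
      subst hb
      exact absurd (hlt hp) (not_lt.2 ha'.2)
  have hmaj : w ∈ {w ∈ rearrangements α | majU V w = 0} := by
    refine ⟨hw, ?_⟩
    rw [majU_eq_sum]
    exact Finset.sum_eq_zero fun i _ => if_neg fun ⟨hi, hp⟩ => List.isChain_ofFn.1 hchain i hi hp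
  rw [← heq] at hmaj
  have hpair := (List.pairwise_ofFn (R := fun a b => (a, b) ∉ V)).2 fun i j hij =>
    invU_eq_zero_iff.1 hmaj.2 i j hij
  rw [hwl, List.pairwise_append, List.pairwise_cons] at hpair
  exact hpair.2.1.1 z (by simp) hxz

/-- By `desc_sortToInv`, the words of maximal sor are mapped injectively into those of maximal inv;
equal cardinalities force equality. -/
theorem maxReflecting_of_equidistributed {α : Fin n → ℕ} {V : Set (Fin n × Fin n)}
    {S : Set (Fin n)} (hV : DescWeakOrder V S) (hS : ∀ x, 0 < α x → x ∈ S)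
    (h : Equidistributed (rearrangements α) (sorU V (∑ x, α x)) (invU V))
    {u : Fin (∑ x, α x) → Fin n} (hu : u ∈ rearrangements α) : MaxReflecting V u := by
  intro w hw hd
  have hwR : w ∈ rearrangements α := fun x => (hw x).trans (hu x)
  have hΦ : ∀ {v : Fin (∑ x, α x) → Fin n}, v ∈ rearrangements α →
      sortToInv _ v ∈ rearrangements α := fun hv x => (cnt_sortToInv _ _ x).trans (hv x)
  have hoff : ∀ {v v' : Fin (∑ x, α x) → Fin n}, v ∈ rearrangements α → v' ∈ rearrangements α →
      offPairs V v = offPairs V v' := fun hv hv' =>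
    offPairs_congr fun x => (hv x).trans (hv' x).symm
  have hsub : sortToInv _ '' {v ∈ rearrangements α | sorU V _ v = offPairs V w}
      ⊆ {v ∈ rearrangements α | invU V v = offPairs V w} := by
    rintro _ ⟨v, ⟨hv, hk⟩, rfl⟩
    refine ⟨hΦ hv, ?_⟩
    rw [hoff hwR (hΦ hv), invU_eq_offPairs_iff]
    refine desc_sortToInv hV _ v (fun i => hS _ ?_) (hk.trans (hoff hwR hv))
    exact mem_occurring.1 (apply_mem_occurring hv i)
  have heq := Set.eq_of_subset_of_ncard_le hsub (by
    rw [Set.ncard_image_of_injective _ (sortToInv_injective _), h]) (Set.toFinite _)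
  have hmem : sortToInv _ w ∈ {v ∈ rearrangements α | invU V v = offPairs V w} :=
    ⟨hΦ hwR, by rw [hoff hwR (hΦ hwR), invU_eq_offPairs_iff]; exact hd⟩
  rw [← heq] at hmem
  obtain ⟨v, hv, hvw⟩ := hmem
  rw [← sortToInv_injective _ hvw]
  rw [hoff hv.1 hwR]
  exact hv.2

/-! ### Equivalence with strict weak orders with small blocks -/

theorem equidistributed_sor_inv {α : Fin n → ℕ} {V : Set (Fin n × Fin n)} {S : Set (Fin n)}
    (hV : DescWeakOrder V S) (hS : ∀ x, 0 < α x → x ∈ S) (hB : SmallBlocks V α) :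
    Equidistributed (rearrangements α) (sorU V (∑ x, α x)) (invU V) := by
  have hstat : ∀ w ∈ rearrangements α, sorU V _ w = invU V (sortToInv _ w) := fun w hw =>
    sorU_eq_invU_sortToInv hV _ w (fun i => hS _ (mem_occurring.1 (apply_mem_occurring hw i)))
      ((cnt_of_mem hw).symm ▸ hB)
  have hmem : ∀ w : Fin (∑ x, α x) → Fin n,
      sortToInv _ w ∈ rearrangements α ↔ w ∈ rearrangements α := fun w =>
    forall_congr' fun x => by
      have := cnt_sortToInv _ w x
      rw [cnt, cnt] at this
      rw [this]
  intro k
  refine Set.ncard_congr (fun w _ => sortToInv _ w) ?_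
    (fun v w _ _ h => sortToInv_injective _ h) ?_
  · rintro w ⟨hw, hk⟩
    exact ⟨(hmem w).2 hw, by rw [← hstat w hw, hk]⟩
  · rintro v ⟨hv, hk⟩
    obtain ⟨w, rfl⟩ := sortToInv_surjective _ v
    exact ⟨w, ⟨(hmem w).1 hv, by rw [hstat w ((hmem w).1 hv), hk]⟩, rfl⟩

/-- The statistics of `U` are equidistributed if and only if the reduced relation is a strict weak
order with small blocks. -/
theorem equidistributed_iff (α : Fin n → ℕ) (U : Set (Fin n × Fin n)) :
    (Equidistributed (rearrangements α) (sorU U (∑ x, α x)) (invU U) ∧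
      Equidistributed (rearrangements α) (invU U) (majU U)) ↔
    DescWeakOrder (reduced α U) (occurring α) ∧ SmallBlocks (reduced α U) α := by
  have hs : ∀ w ∈ rearrangements α, sorU U (∑ x, α x) w = sorU (reduced α U) _ w := fun w hw =>
    sorU_congr _ w fun i j hij => mem_reduced_iff_of_ne U hw fun h => hij.ne (by rw [h])
  have hi : ∀ w ∈ rearrangements α, invU U w = invU (reduced α U) w := fun w hw =>
    invU_congr fun i j hij => mem_reduced_iff_of_ne U hw hij.ne
  have hm : ∀ w ∈ rearrangements α, majU U w = majU (reduced α U) w := fun w hw =>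
    majU_congr fun i j hij => mem_reduced_iff_of_ne U hw hij.ne
  constructor
  · rintro ⟨h1, h2⟩
    replace h1 := h1.congr hs hi
    replace h2 := h2.congr hi hm
    have hV := descWeakOrder_reduced (fun h => lt_of_mem_reduced h1 h) h2
    refine ⟨hV, ?_⟩
    obtain ⟨u, hu⟩ := rearrangements_nonempty α
    have := (maxReflecting_of_equidistributed hV (fun x hx => mem_occurring.2 hx) h1 hu).smallBlocks
      hV _ u (fun i => apply_mem_occurring hu i)
    rwa [cnt_of_mem hu] at this
  · rintro ⟨hV, hB⟩
    have hS : ∀ x, 0 < α x → x ∈ (occurring α : Set (Fin n)) := fun x hx => mem_occurring.2 hx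
    have h1 := equidistributed_sor_inv hV hS hB
    have h2 := equidistributed_inv_maj α (reduced α U) (by
      intro c u x hc hu hx hcx hux
      have hcu : (c, u) ∈ reduced α U := by
        rcases hV.neg (hS c hc) (hS u hu) (hS x hx) hcx with h | h
        · exact h
        · exact absurd h hux
      exact ⟨hcu, fun h => absurd (hV.lt h) (hV.lt hcu).not_gt⟩)
    exact ⟨h1.congr (fun w hw => (hs w hw).symm) fun w hw => (hi w hw).symm,
      h2.congr (fun w hw => (hi w hw).symm) fun w hw => (hm w hw).symm⟩

/-! ### Ordered bipartitions and strict weak orders -/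

theorem OrderedBipartition.mem_rel_iff {X : Type*} [DecidableEq X] {S : Finset X}
    (B : OrderedBipartition S) (hB : ∀ i, ¬ B.underlined i) {x y : X} {i j : Fin B.k}
    (hx : x ∈ B.block i) (hy : y ∈ B.block j) : (x, y) ∈ B.rel ↔ i < j := by
  have huniq : ∀ {z i j}, z ∈ B.block i → z ∈ B.block j → i = j := by
    intro z i j hi hj
    by_contra hne
    exact Finset.disjoint_left.1 (B.disjoint i j hne) hi hj
  constructor
  · rintro (⟨i', j', hij, hx', hy'⟩ | ⟨i', hu, -⟩)
    · rwa [huniq hx hx', huniq hy hy']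
    · exact absurd hu (hB i')
  · exact fun hij => Or.inl ⟨i, j, hij, hx, hy⟩

theorem OrderedBipartition.exists_block {X : Type*} [DecidableEq X] {S : Finset X}
    (B : OrderedBipartition S) {x : X} (hx : x ∈ S) : ∃ i, x ∈ B.block i := by
  rw [← B.cover, Finset.mem_biUnion] at hx
  obtain ⟨i, -, hi⟩ := hx
  exact ⟨i, hi⟩

theorem OrderedBipartition.mem_of_mem_block {X : Type*} [DecidableEq X] {S : Finset X}
    (B : OrderedBipartition S) {x : X} {i : Fin B.k} (hx : x ∈ B.block i) : x ∈ S := by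
  rw [← B.cover, Finset.mem_biUnion]
  exact ⟨i, Finset.mem_univ _, hx⟩

/-- A negatively transitive relation that is compatible with the order is bipartitional without
underlined blocks. -/
theorem DescWeakOrder.exists_orderedBipartition {V : Set (Fin n × Fin n)} {S : Finset (Fin n)}
    (hV : DescWeakOrder V S) (hS : ∀ x y, (x, y) ∈ V → x ∈ S ∧ y ∈ S) :
    ∃ B : OrderedBipartition S, V = B.rel ∧ ∀ i, ¬ B.underlined i := by
  classical
  -- The number of letters above `x` ranks the letters: it is constant on incomparability classes
  -- and grows along `V`. Its level sets, in increasing order, are the blocks.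
  let f : Fin n → ℕ := fun x => (S.filter fun z => (z, x) ∈ V).card
  have hf : ∀ x ∈ S, ∀ y ∈ S, (x, y) ∈ V ↔ f x < f y := by
    intro x hx y hy
    constructor
    · intro hxy
      refine Finset.card_lt_card ((Finset.ssubset_iff_of_subset fun z hz => ?_).2 ⟨x, ?_, ?_⟩)
      · rw [Finset.mem_filter] at hz ⊢
        refine ⟨hz.1, ?_⟩
        rcases hV.neg hz.1 hy hx hz.2 with h | h
        · exact h
        · exact absurd (hV.lt h) (hV.lt hxy).not_gt
      · exact Finset.mem_filter.2 ⟨hx, hxy⟩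
      · exact fun h => lt_irrefl _ (hV.lt (Finset.mem_filter.1 h).2)
    · intro hlt
      by_contra hxy
      refine absurd hlt (not_lt.2 (Finset.card_le_card fun z hz => ?_))
      rw [Finset.mem_filter] at hz ⊢
      refine ⟨hz.1, ?_⟩
      rcases hV.neg hz.1 hx hy hz.2 with h | h
      · exact h
      · exact absurd h hxy
  let T := S.image f
  let g : Fin T.card ↪o ℕ := T.orderEmbOfFin rfl
  have hg : ∀ x ∈ S, ∃ i, g i = f x := fun x hx => by
    have : f x ∈ Set.range g := by
      rw [Finset.range_orderEmbOfFin]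
      exact Finset.mem_image_of_mem f hx
    exact this
  let B : OrderedBipartition S :=
    { k := T.card
      block := fun i => S.filter fun x => f x = g i
      underlined := fun _ => False
      nonempty := fun i => by
        obtain ⟨x, hx, hi⟩ := Finset.mem_image.1 (T.orderEmbOfFin_mem rfl i)
        exact ⟨x, Finset.mem_filter.2 ⟨hx, hi⟩⟩
      disjoint := fun i j hij => Finset.disjoint_left.2 fun x hi hj => hij (g.injective
        ((Finset.mem_filter.1 hi).2.symm.trans (Finset.mem_filter.1 hj).2))
      cover := by
        ext x
        simp only [Finset.mem_biUnion, Finset.mem_univ, true_and, Finset.mem_filter]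
        refine ⟨fun ⟨_, h, _⟩ => h, fun h => ?_⟩
        obtain ⟨i, hi⟩ := hg x h
        exact ⟨i, h, hi.symm⟩ }
  have hBu : ∀ i, ¬ B.underlined i := fun _ h => h
  refine ⟨B, ?_, hBu⟩
  ext ⟨x, y⟩
  by_cases hxy : x ∈ S ∧ y ∈ S
  · obtain ⟨i, hi⟩ := B.exists_block hxy.1
    obtain ⟨j, hj⟩ := B.exists_block hxy.2
    rw [B.mem_rel_iff hBu hi hj, hf x hxy.1 y hxy.2, (Finset.mem_filter.1 hi).2,
      (Finset.mem_filter.1 hj).2]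
    exact g.lt_iff_lt
  · refine iff_of_false (fun h => hxy (hS x y h)) ?_
    rintro (⟨i, j, -, hi, hj⟩ | ⟨i, h, -⟩)
    · exact hxy ⟨B.mem_of_mem_block hi, B.mem_of_mem_block hj⟩
    · exact h

theorem exists_between_of_two_lt_card {s : Finset (Fin n)} (hs : 2 < s.card) :
    ∃ y ∈ s, ∃ b ∈ s, ∃ a ∈ s, y < b ∧ b < a := by
  obtain ⟨x, y, z, hx, hy, hz, hxy, hxz, hyz⟩ := Finset.two_lt_card_iff.1 hs
  rcases lt_or_gt_of_ne hxy with h1 | h1 <;> rcases lt_or_gt_of_ne hxz with h2 | h2 <;>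
    rcases lt_or_gt_of_ne hyz with h3 | h3
  · exact ⟨x, hx, y, hy, z, hz, h1, h3⟩
  · exact ⟨x, hx, z, hz, y, hy, h2, h3⟩
  · exact absurd (h1.trans h3) h2.not_gt
  · exact ⟨z, hz, x, hx, y, hy, h2, h1⟩
  · exact ⟨y, hy, x, hx, z, hz, h1, h2⟩
  · exact absurd (h2.trans h3) h1.not_gt
  · exact ⟨y, hy, z, hz, x, hx, h3, h2⟩
  · exact ⟨z, hz, y, hy, x, hx, h3, h1⟩

end GraphicalSorting

theorem theorem3 {n : ℕ} (α : Fin n → ℕ) (U : Set (Fin n × Fin n)) :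
    (GraphicalSorting.Equidistributed (GraphicalSorting.rearrangements α)
        (GraphicalSorting.sorU U (∑ x, α x)) (GraphicalSorting.invU U) ∧
      GraphicalSorting.Equidistributed (GraphicalSorting.rearrangements α)
        (GraphicalSorting.invU U) (GraphicalSorting.majU U)) ↔
    ∃ B : GraphicalSorting.OrderedBipartition (GraphicalSorting.occurring α),
      (GraphicalSorting.reduced α U = B.rel ∧ ∀ i, ¬ B.underlined i) ∧
      (∀ x y, (x, y) ∈ GraphicalSorting.reduced α U → x > y) ∧
      (∀ i : Fin B.k, i.val + 1 < B.k → (B.block i).card ≤ 2) ∧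
      (∀ i : Fin B.k, i.val + 1 < B.k → (B.block i).card = 2 →
        α ((B.block i).max' (B.nonempty i)) = 1) := by
  rw [GraphicalSorting.equidistributed_iff]
  set V := GraphicalSorting.reduced α U with hVdef
  constructor
  · rintro ⟨hV, hS⟩
    obtain ⟨B, hrel, hB⟩ := hV.exists_orderedBipartition fun x y h => ⟨h.2.1, h.2.2.1⟩
    have hmem : ∀ {x y i j}, x ∈ B.block i → y ∈ B.block j → ((x, y) ∈ V ↔ i < j) :=
      fun hx hy => by rw [hrel]; exact B.mem_rel_iff hB hx hy
    have hpos : ∀ {x i}, x ∈ B.block i → 0 < α x := fun hx =>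
      GraphicalSorting.mem_occurring.1 (B.mem_of_mem_block hx)
    have key : ∀ i : Fin B.k, i.val + 1 < B.k → ∀ y ∈ B.block i, ∀ b ∈ B.block i, y < b →
        α b ≤ 1 ∧ ∀ a ∈ B.block i, ¬ b < a := by
      intro i hi y hy b hb hyb
      -- A letter of the next block is the lower letter that `SmallBlocks` asks for; this is why the
      -- last block is exempt.
      obtain ⟨d, hd⟩ := B.nonempty ⟨i.val + 1, hi⟩
      obtain ⟨h1, h2⟩ := hS y b d (hpos hy) (hpos hb) (hpos hd) hyb
        (fun h => lt_irrefl _ ((hmem hb hy).1 h)) ((hmem hb hd).2 (Nat.lt_succ_self _))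
      exact ⟨h1, fun a ha hba => lt_irrefl _ ((hmem ha hb).1 (h2 a (hpos ha) hba))⟩
    refine ⟨B, ⟨hrel, hB⟩, fun x y h => hV.lt h, fun i hi => ?_, fun i hi hc => ?_⟩
    · by_contra hlt
      obtain ⟨y, hy, b, hb, a, ha, hyb, hba⟩ :=
        GraphicalSorting.exists_between_of_two_lt_card (not_le.1 hlt)
      exact (key i hi y hy b hb hyb).2 a ha hba
    · have hb := (B.block i).max'_mem (B.nonempty i)
      obtain ⟨y, hy, hne⟩ := Finset.exists_mem_ne (by omega : 1 < (B.block i).card)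
        ((B.block i).max' (B.nonempty i))
      have h1 := (key i hi y hy _ hb (lt_of_le_of_ne ((B.block i).le_max' y hy) hne)).1
      have h2 := hpos hb
      omega
  · rintro ⟨B, ⟨hrel, hB⟩, hlt, h2, h1⟩
    have hmem : ∀ {x y i j}, x ∈ B.block i → y ∈ B.block j → ((x, y) ∈ V ↔ i < j) :=
      fun hx hy => by rw [hrel]; exact B.mem_rel_iff hB hx hy
    refine ⟨⟨fun h => hlt _ _ h, fun {x y z} hx hy hz h => ?_⟩, ?_⟩
    · obtain ⟨i, hi⟩ := B.exists_block hx
      obtain ⟨j, hj⟩ := B.exists_block hy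
      obtain ⟨l, hl⟩ := B.exists_block hz
      rw [hmem hi hl] at h
      rw [hmem hi hj, hmem hj hl]
      exact (lt_or_ge i j).imp_right fun hji => hji.trans_lt h
    · intro y b d hy hb hd hyb hby hbd
      obtain ⟨j, hj⟩ := B.exists_block (GraphicalSorting.mem_occurring.2 hy)
      obtain ⟨i, hi⟩ := B.exists_block (GraphicalSorting.mem_occurring.2 hb)
      obtain ⟨l, hl⟩ := B.exists_block (GraphicalSorting.mem_occurring.2 hd)
      rw [hmem hi hj, not_lt] at hby
      rw [hmem hi hl] at hbd
      have hij : j = i := by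
        rcases hby.eq_or_lt with h | h
        · exact h
        · exact absurd (hlt _ _ ((hmem hj hi).2 h)) hyb.not_gt
      subst hij
      -- The letter `d` lies in a later block, so the common block of `y` and `b` is not the last
      -- one.
      have hk : j.val + 1 < B.k := by
        have := l.2
        rw [Fin.lt_def] at hbd
        omega
      have hcard := h2 j hk
      have hnone : ∀ a ∈ B.block j, ¬ b < a := by
        intro a ha hba
        exact absurd hcard (not_le.2 (Finset.two_lt_card_iff.2
          ⟨y, b, a, hj, hi, ha, hyb.ne, (hyb.trans hba).ne, hba.ne⟩))
      have hmax : (B.block j).max' (B.nonempty j) = b :=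
        le_antisymm ((Finset.max'_le_iff _ _).2 fun a ha => not_lt.1 (hnone a ha))
          ((B.block j).le_max' b hi)
      have htwo : 1 < (B.block j).card := Finset.one_lt_card.2 ⟨y, hj, b, hi, hyb.ne⟩
      have hone := h1 j hk (by omega)
      rw [hmax] at hone
      refine ⟨hone.le, fun a ha hba => ?_⟩
      obtain ⟨p, hp⟩ := B.exists_block (GraphicalSorting.mem_occurring.2 ha)
      rw [hmem hp hi]
      rcases lt_trichotomy p j with h | h | h
      · exact h
      · exact absurd hba (hnone a (h ▸ hp))
      · exact absurd (hlt _ _ ((hmem hi hp).2 h)) hba.not_gt
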